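/- Let $0<a<1$. For $N\ge 1$ let $X^N$ be the continuous-time Markov chain on $S_N=\{-1,-1+\tfrac1N,\dots,1\}$ that jumps from $x$ to $x+\frac1N$ at rate $N(1-x)$ and to $x-\frac1N$ at rate $N(1+x)$, with initial law $\mu_N$ on $S_N$, where $(\mu_N)$ satisfies the large deviation principle with rate $N$ and rate function $i(x)=(x^2-a^2)^2$ for $x\in[-1,1]$, $i(x)=\infty$ otherwise. Let $H(x,p)=(e^p-1)(1-x)+(e^{-p}-1)(1+x)$ and $L(x,v)=\sup_{p\in\mathbb R}(pv-H(x,p))$. For $T>0$ and $b\in[-1,1]$, an *optimal path* to $b$ is a minimizer of $\mathcal I(\gamma)=i(\gamma_0)+\int_0^T L(\gamma_s,\dot\gamma_s)\,ds$ among the absolutely continuous $\gamma:[0,T]\to[-1,1]$ with $\gamma_T=b$. A point $b\in[-1,1]$ is *bad at time $T$* if (1) there is no $x$ such that, for all sequences $y_N\in S_N$ with $y_N\to b$, the law of $X^N_0$ given $X^N_T=y_N$ converges in distribution to $\delta_x$; and (2) there are sequences $b_k^+\to b$, $b_k^-\to b$ in $[-1,1]$ and $\delta>0$ such that for all large $k$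 and all sequences $y_N,z_N\in S_N$ with $y_N\to b_k^+$, $z_N\to b_k^-$, the variational distance between the laws of $X^N_0$ given $X^N_T=y_N$ and given $X^N_T=z_N$ is at least $\delta$ for all large $N$. Then: (a) For all $T>0$ and $b\in[-1,1]$ an optimal path to $b$ exists, and every optimal path has the form $x_t=C_1e^{2t}+C_2e^{-2t}$, $0\le t\le T$. The constants satisfy the terminal condition $C_1e^{2T}+C_2e^{-2T}=b$ and, if $b=0$ or $|x_0|<1$, the open-end condition $\dot x_0=(1-x_0)e^{p_0}-(1+x_0)e^{-p_0}$ with $p_0=i'(x_0)=4x_0(x_0^2-a^2)$, that is, $2(C_1-C_2)=(1-x_0)e^{p_0}-(1+x_0)e^{-p_0}$. (b) There is $T_0>0$, depending only on $a$, such that for $0<T\le T_0$ there are no bad points. (c) There is $T_1>0$, depending only on $a$, such that for $T\ge T_1$ the point $0$ is the unique bad point. If moreover every $\mu_N$ is symmetric under $x\mapsto -x$, then for $T\ge T_1$ the law of $X^N_0$ given exactly $X^N_T=0$ does not converge to a point mass. -/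

import Mathlib

open Filter Topology MeasureTheory ProbabilityTheory
open scoped ENNReal BoundedContinuousFunction

noncomputable section

/-! ## The walk with small increments -/

/-- The generator of the walk that jumps from `x` to `x + 1/N` at rate `N * b x` and to
`x - 1/N` at rate `N * d x`. -/
def walkGenerator (b d : ℝ → ℝ) (N : ℕ) (f : ℝ → ℝ) (x : ℝ) : ℝ :=
  N * b x * (f (x + 1 / N) - f x) + N * d x * (f (x - 1 / N) - f x)

/-- Birth rate `1 - x` of the mean-field independent spin flip dynamics. -/
def spinBirth (x : ℝ) : ℝ := 1 - x

/-- Death rate `1 + x` of the mean-field independent spin flip dynamics. -/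
def spinDeath (x : ℝ) : ℝ := 1 + x

/-- The `2 * N + 1` points `-1, -1 + 1/N, …, 1 - 1/N, 1` of the state space of the walk.
The spin flip rates vanish where a jump would leave this set. -/
def site (N : ℕ) (j : Fin (2 * N + 1)) : ℝ := ((j : ℝ) - N) / N

/-- The matrix of the generator of the spin flip walk on its finite state space: the entry
`(i, j)` is the generator applied to the indicator of `site N j`, evaluated at `site N i`. -/
def spinQ (N : ℕ) : Matrix (Fin (2 * N + 1)) (Fin (2 * N + 1)) ℝ :=
  fun i j => walkGenerator spinBirth spinDeath N
    (Set.indicator {site N j} (fun _ => (1 : ℝ))) (site N i)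

/-- The transition probabilities at time `t` of the continuous-time Markov chain with generator
`spinQ N`. -/
def spinTransition (N : ℕ) (t : ℝ) : Matrix (Fin (2 * N + 1)) (Fin (2 * N + 1)) ℝ :=
  NormedSpace.exp (t • spinQ N)

/-- The joint law of `(X_0, X_T)` when `X` is the spin flip walk with initial law `μ` (a measure
carried by the sites). -/
def endpointLaw (N : ℕ) (T : ℝ) (μ : Measure ℝ) : Measure (ℝ × ℝ) :=
  ∑ i, ∑ j, (μ {site N i} * ENNReal.ofReal (spinTransition N T i j)) •
    Measure.dirac (site N i, site N j)

/-- The conditional law of `X_0` given `X_T = y`. -/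
def initialLawGiven (N : ℕ) (T : ℝ) (μ : Measure ℝ) (y : ℝ) : Measure ℝ :=
  (cond (endpointLaw N T μ) {z | z.2 = y}).map Prod.fst

/-! ## Large deviations -/

/-- The large deviation principle with rate `n` and rate function `I`. -/
def HasLDP (μ : ℕ → Measure ℝ) (I : ℝ → ℝ≥0∞) : Prop :=
  (∀ C : Set ℝ, IsClosed C →
    limsup (fun n : ℕ => ENNReal.log (μ n C) / (n : EReal)) atTop
      ≤ -((⨅ x ∈ C, I x : ℝ≥0∞) : EReal)) ∧
  (∀ G : Set ℝ, IsOpen G →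
    -((⨅ x ∈ G, I x : ℝ≥0∞) : EReal)
      ≤ liminf (fun n : ℕ => ENNReal.log (μ n G) / (n : EReal)) atTop)

open Classical in
/-- The initial rate function `(x² - a²)²` on `[-1, 1]`, infinite elsewhere. -/
def initialRate (a x : ℝ) : ℝ≥0∞ :=
  if x ∈ Set.Icc (-1 : ℝ) 1 then ENNReal.ofReal ((x ^ 2 - a ^ 2) ^ 2) else ⊤

/-- `μ N` is an initial law on the state space of the `N`-th walk, for every `N`, and these laws
satisfy the large deviation principle with rate function `initialRate a`. -/
structure IsInitialSequence (a : ℝ) (μ : ℕ → Measure ℝ) : Prop where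
  isProbabilityMeasure : ∀ N, IsProbabilityMeasure (μ N)
  carried_by_sites : ∀ N, μ N (Set.range (site N)) = 1
  ldp : HasLDP μ (initialRate a)

/-! ## Bad points -/

/-- Convergence in distribution, tested on bounded continuous functions. -/
def WeaklyTendsto (ν : ℕ → Measure ℝ) (ν' : Measure ℝ) : Prop :=
  ∀ f : ℝ →ᵇ ℝ, Tendsto (fun n => ∫ x, f x ∂(ν n)) atTop (𝓝 (∫ x, f x ∂ν'))

/-- The variational distance. -/
def variationalDist (ν ν' : Measure ℝ) : ℝ :=
  ⨆ A : {A : Set ℝ // MeasurableSet A}, |ν.real A - ν'.real A|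

/-- `y N` is a point of the state space of the `N`-th walk, and these points converge to `b`.
A real `b` need not belong to these state spaces; conditioning on `X^N_T = b` for large `N`
means conditioning on `X^N_T = y N` for such approximations. -/
def ApproachesThroughSites (y : ℕ → ℝ) (b : ℝ) : Prop :=
  (∀ N, y N ∈ Set.range (site N)) ∧ Tendsto y atTop (𝓝 b)

/-- Conditional on `X^N_T = b`, `X^N_0` converges in distribution to a point mass. -/
def ConditionedConvergesToPointMass (μ : ℕ → Measure ℝ) (T b : ℝ) : Prop :=
  ∃ x : ℝ, ∀ y : ℕ → ℝ, ApproachesThroughSites y b →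
    WeaklyTendsto (fun N => initialLawGiven N T (μ N) (y N)) (Measure.dirac x)

/-- There are two sequences of terminal points with limit `b` such that, from some index on, the
conditional laws of `X^N_0` for the two terminal points are at variational distance at least
`δ`, for `N` large. -/
def ConditionedLawsSeparate (μ : ℕ → Measure ℝ) (T b : ℝ) : Prop :=
  ∃ bp bm : ℕ → ℝ, (∀ k, bp k ∈ Set.Icc (-1 : ℝ) 1) ∧ (∀ k, bm k ∈ Set.Icc (-1 : ℝ) 1) ∧
    Tendsto bp atTop (𝓝 b) ∧ Tendsto bm atTop (𝓝 b) ∧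
    ∃ δ : ℝ, 0 < δ ∧ ∀ᶠ k in atTop, ∀ y z : ℕ → ℝ,
      ApproachesThroughSites y (bp k) → ApproachesThroughSites z (bm k) →
        ∀ᶠ N in atTop, δ ≤ variationalDist (initialLawGiven N T (μ N) (y N))
          (initialLawGiven N T (μ N) (z N))

/-- The set of points of `[-1, 1]` that are bad at time `T`. -/
def badPoints (μ : ℕ → Measure ℝ) (T : ℝ) : Set ℝ :=
  {b | b ∈ Set.Icc (-1 : ℝ) 1 ∧ ¬ ConditionedConvergesToPointMass μ T b ∧
    ConditionedLawsSeparate μ T b}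

/-! ## The action -/

/-- The Hamiltonian of the walk with rates `b` and `d`. -/
def hamiltonian (b d : ℝ → ℝ) (x p : ℝ) : ℝ :=
  (Real.exp p - 1) * b x + (Real.exp (-p) - 1) * d x

/-- The Hamiltonian is the limit of the logarithmic generators of the walk. -/
theorem hamiltonian_eq_lim (b d : ℝ → ℝ) (x p : ℝ) :
    Tendsto (fun N : ℕ => (1 / (N : ℝ)) * (Real.exp (-(N * p * x)) *
      walkGenerator b d N (fun z => Real.exp (N * p * z)) x)) atTop
      (𝓝 (hamiltonian b d x p)) := by
  refine tendsto_const_nhds.congr' ?_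
  filter_upwards [eventually_gt_atTop 0] with N hN
  have hN' : (N : ℝ) ≠ 0 := by exact_mod_cast hN.ne'
  have h1 : (N : ℝ) * p * (x + 1 / N) = N * p * x + p := by field_simp
  have h2 : (N : ℝ) * p * (x - 1 / N) = N * p * x + -p := by field_simp; ring
  have h3 : Real.exp (-(N * p * x)) * Real.exp (N * p * x) = 1 := by
    rw [← Real.exp_add]; simp
  simp only [walkGenerator, hamiltonian, h1, h2, Real.exp_add]
  have h4 : (1 / (N : ℝ)) * N = 1 := by field_simp
  linear_combination (-(b x * (Real.exp p - 1) + d x * (Real.exp (-p) - 1))) *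
    (h4 * (Real.exp (-(N * p * x)) * Real.exp (N * p * x)) + h3)

/-- The Lagrangian `L(x, v) = sup_p (p v - H(x, p))` of the spin flip walk, with values in
`[0, ∞]`. It is nonnegative because `H(x, 0) = 0`, so that truncating the terms at `0` does not
change the supremum. -/
def spinLagrangian (x v : ℝ) : ℝ≥0∞ :=
  ⨆ p : ℝ, ENNReal.ofReal (p * v - hamiltonian spinBirth spinDeath x p)

/-- The action: initial cost plus the integral of the Lagrangian along the path. -/
def action (a T : ℝ) (γ : ℝ → ℝ) : ℝ≥0∞ :=
  initialRate a (γ 0) + ∫⁻ t in Set.Icc 0 T, spinLagrangian (γ t) (deriv γ t)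

/-- `γ` is an absolutely continuous path in `[-1, 1]` on the time interval `[0, T]` that ends
at `b`. -/
def IsPathTo (T b : ℝ) (γ : ℝ → ℝ) : Prop :=
  AbsolutelyContinuousOnInterval γ 0 T ∧ (∀ t ∈ Set.Icc 0 T, γ t ∈ Set.Icc (-1 : ℝ) 1) ∧
    γ T = b

/-- `γ` minimizes the action among the paths that end at `b` at time `T`, with free initial
point. -/
def IsOptimalPathTo (a T b : ℝ) (γ : ℝ → ℝ) : Prop :=
  IsPathTo T b γ ∧ ∀ η : ℝ → ℝ, IsPathTo T b η → action a T γ ≤ action a T η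

end

/-! ## Transition probabilities of the spin flip walk -/

theorem hasDerivAt_exp_smul_apply {n : ℕ} (Q : Matrix (Fin n) (Fin n) ℝ) (t : ℝ) (i j : Fin n) :
    HasDerivAt (fun u : ℝ => NormedSpace.exp (u • Q) i j) ((NormedSpace.exp (t • Q) * Q) i j) t := by
  open scoped Matrix.Norms.Operator in
  have h := hasDerivAt_exp_smul_const (𝕂 := ℝ) Q t
  let e : Matrix (Fin n) (Fin n) ℝ →L[ℝ] ℝ :=
    LinearMap.toContinuousLinearMap (Matrix.entryLinearMap ℝ ℝ i j)
  exact e.hasFDerivAt.comp_hasDerivAt t h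

theorem sum_spinQ_mul {N : ℕ} (hN : N ≠ 0) (i : Fin (2 * N + 1)) (f : ℕ → ℝ) :
    ∑ j, spinQ N i j * f j =
      (2 * N - i) * (f (i + 1) - f i) + i * (f (i - 1) - f i) := by
  have hN' : (N : ℝ) ≠ 0 := by exact_mod_cast hN
  have hb : (N : ℝ) * spinBirth (site N i) = 2 * N - i := by
    simp only [spinBirth, site]; field_simp; ring
  have hd : (N : ℝ) * spinDeath (site N i) = i := by
    simp only [spinDeath, site]; field_simp; ring
  have h1 : ∀ j : Fin (2 * N + 1), site N i + 1 / N = site N j ↔ (j : ℕ) = i + 1 := by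
    intro j
    simp only [site]
    rw [← add_div, div_left_inj' hN', ← @Nat.cast_inj ℝ]
    push_cast
    constructor <;> intro h <;> linarith
  have h2 : ∀ j : Fin (2 * N + 1), site N i - 1 / N = site N j ↔ (j : ℕ) + 1 = i := by
    intro j
    simp only [site]
    rw [← sub_div, div_left_inj' hN', ← @Nat.cast_inj ℝ]
    push_cast
    constructor <;> intro h <;> linarith
  have h3 : ∀ j : Fin (2 * N + 1), site N i = site N j ↔ j = i := by
    intro j
    simp only [site]
    rw [div_left_inj' hN', Fin.ext_iff, ← @Nat.cast_inj ℝ]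
    constructor <;> intro h <;> linarith
  have hi : (i : ℕ) < 2 * N + 1 := i.2
  have s3 : ∑ j : Fin (2 * N + 1), (if j = i then (1 : ℝ) else 0) * f j = f i := by simp
  have s1 : (2 * N - i : ℝ) * ∑ j : Fin (2 * N + 1),
      (if (j : ℕ) = i + 1 then (1 : ℝ) else 0) * f j = (2 * N - i) * f (i + 1) := by
    rcases Nat.lt_or_ge (i : ℕ) (2 * N) with h | h
    · rw [Finset.sum_eq_single (⟨i + 1, by omega⟩ : Fin (2 * N + 1))]
      · simp
      · intro j _ hj
        rw [if_neg, zero_mul]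
        exact fun h' => hj (Fin.ext h')
      · simp
    · have : (i : ℝ) = 2 * N := by
        have : (i : ℕ) = 2 * N := by omega
        rw [this]; push_cast; ring
      rw [this]; simp
  have s2 : (i : ℝ) * ∑ j : Fin (2 * N + 1),
      (if (j : ℕ) + 1 = i then (1 : ℝ) else 0) * f j = i * f (i - 1) := by
    rcases Nat.eq_zero_or_pos (i : ℕ) with h | h
    · rw [h]; simp
    · rw [Finset.sum_eq_single (⟨i - 1, by omega⟩ : Fin (2 * N + 1))]
      · rw [if_pos (by simp; omega), one_mul]
      · intro j _ hj
        rw [if_neg, zero_mul]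
        exact fun h' => hj (Fin.ext (by simp; omega))
      · simp
  have key : ∀ j : Fin (2 * N + 1), spinQ N i j * f j =
      (2 * N - i) * ((if (j : ℕ) = i + 1 then (1 : ℝ) else 0) * f j) +
      i * ((if (j : ℕ) + 1 = i then (1 : ℝ) else 0) * f j) -
      (2 * N) * ((if j = i then (1 : ℝ) else 0) * f j) := by
    intro j
    simp only [spinQ, walkGenerator, hb, hd, Set.indicator_apply, Set.mem_singleton_iff, h1, h2, h3]
    ring
  simp_rw [key]
  rw [Finset.sum_sub_distrib, Finset.sum_add_distrib, ← Finset.mul_sum, ← Finset.mul_sum,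
    ← Finset.mul_sum, s1, s2, s3]
  ring

/-- The product weights of `2 * N` independent spins with mean `w`, as a function of the number of
up spins. -/
noncomputable def spinWeight (N : ℕ) (w : ℝ) (j : ℕ) : ℝ := (1 + w) ^ j * (1 - w) ^ (2 * N - j)

theorem hasDerivAt_spinWeight {N : ℕ} (hN : N ≠ 0) (w : ℝ) (i : Fin (2 * N + 1)) :
    ∃ D : ℝ, HasDerivAt (fun w => spinWeight N w i) D w ∧
      ∑ j, spinQ N i j * spinWeight N w j = -2 * w * D := by
  have e1 : HasDerivAt (fun w : ℝ => 1 + w) 1 w := (hasDerivAt_id w).const_add 1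
  have e2 : HasDerivAt (fun w : ℝ => 1 - w) (-1) w := by
    simpa using (hasDerivAt_id w).const_sub 1
  refine ⟨_, (e1.fun_pow (i : ℕ)).fun_mul (e2.fun_pow (2 * N - i)), ?_⟩
  rw [sum_spinQ_mul hN i (spinWeight N w)]
  have hi : (i : ℕ) < 2 * N + 1 := i.2
  generalize (i : ℕ) = k at *
  obtain ⟨l, hl⟩ : ∃ l, 2 * N = k + l := ⟨2 * N - k, by omega⟩
  have hl' : (2 * N : ℝ) - k = l := by
    have : ((2 * N : ℕ) : ℝ) = (k + l : ℕ) := by rw [hl]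
    push_cast at this; linarith
  rw [hl']
  simp only [spinWeight, hl, Nat.add_sub_cancel_left]
  rcases k with _ | k <;> rcases l with _ | l
  · simp
  · simp only [Nat.zero_add, Nat.add_sub_cancel]; push_cast; ring
  · simp only [Nat.add_sub_cancel, Nat.add_zero,
      show k + 1 - k = 1 by omega]
    push_cast; ring
  · simp only [Nat.add_sub_cancel, show k + 1 + (l + 1) - (k + 1 + 1) = l by omega,
      show k + 1 + (l + 1) - k = l + 2 by omega]
    push_cast; ring

/-- A product of spins with mean `w` evolves into a product of spins with mean `e⁻²ᵀ w`. -/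
theorem sum_spinTransition_mul_spinWeight {N : ℕ} (hN : N ≠ 0) (T w : ℝ) (i : Fin (2 * N + 1)) :
    ∑ j, spinTransition N T i j * spinWeight N w j =
      spinWeight N (Real.exp (-2 * T) * w) i := by
  let g : ℝ → ℝ := fun t => ∑ j, NormedSpace.exp ((T - t) • spinQ N) i j *
    spinWeight N (w * Real.exp (-2 * t)) j
  have hg : ∀ t, HasDerivAt g 0 t := by
    intro t
    choose D hD1 hD2 using fun k => hasDerivAt_spinWeight hN (w * Real.exp (-2 * t)) k
    have h1 : ∀ j, HasDerivAt (fun t => NormedSpace.exp ((T - t) • spinQ N) i j)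
        (-(NormedSpace.exp ((T - t) • spinQ N) * spinQ N) i j) t := by
      intro j
      have := (hasDerivAt_exp_smul_apply (spinQ N) (T - t) i j).comp t
        ((hasDerivAt_id t).const_sub T)
      simpa [Function.comp_def] using this
    have h2 : HasDerivAt (fun t => w * Real.exp (-2 * t)) (-2 * (w * Real.exp (-2 * t))) t := by
      have := (((hasDerivAt_id t).const_mul (-2)).exp).const_mul w
      convert! this using 1
      simp; ring
    have h3 : ∀ j : Fin (2 * N + 1), HasDerivAt (fun t => spinWeight N (w * Real.exp (-2 * t)) j)
        (∑ k, spinQ N j k * spinWeight N (w * Real.exp (-2 * t)) k) t := by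
      intro j
      have := (hD1 j).comp t h2
      rw [hD2 j]
      convert! this using 1
      ring
    have h4 := HasDerivAt.fun_sum (u := Finset.univ) fun j _ => (h1 j).fun_mul (h3 j)
    convert! h4 using 1
    rw [Finset.sum_add_distrib]
    simp_rw [Matrix.mul_apply, neg_mul, Finset.sum_neg_distrib, Finset.mul_sum, Finset.sum_mul]
    rw [Finset.sum_comm, eq_comm, neg_add_eq_zero]
    exact Finset.sum_congr rfl fun _ _ => Finset.sum_congr rfl fun _ _ => by ring
  have hc : g 0 = g T := is_const_of_deriv_eq_zero (fun t => (hg t).differentiableAt)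
    (fun t => (hg t).deriv) 0 T
  have hg0 : g 0 = ∑ j, spinTransition N T i j * spinWeight N w j := by
    simp [g, spinTransition]
  have hgT : g T = spinWeight N (Real.exp (-2 * T) * w) i := by
    simp [g, Matrix.one_apply, mul_comm]
  rw [← hg0, hc, hgT]

/-! ## Log-concave sequences -/

/-- Log-concavity of a sequence of nonnegative reals without internal zeros. -/
def LogConcaveSeq (a : ℕ → ℝ) : Prop :=
  (∀ n, 0 ≤ a n) ∧ ∀ m n, m ≤ n → a m * a (n + 2) ≤ a (m + 1) * a (n + 1)

theorem LogConcaveSeq.coeff_mul_linear {p : Polynomial ℝ} (hp : LogConcaveSeq p.coeff)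
    {c d : ℝ} (hc : 0 ≤ c) (hd : 0 ≤ d) :
    LogConcaveSeq (p * (Polynomial.C c + Polynomial.C d * Polynomial.X)).coeff := by
  obtain ⟨h0, h⟩ := hp
  have z : (p * (Polynomial.C c + Polynomial.C d * Polynomial.X)).coeff 0 = c * p.coeff 0 := by
    rw [Polynomial.mul_coeff_zero, Polynomial.coeff_add, Polynomial.mul_coeff_zero (Polynomial.C d),
      Polynomial.coeff_C_zero, Polynomial.coeff_X_zero]
    ring
  have s : ∀ n, (p * (Polynomial.C c + Polynomial.C d * Polynomial.X)).coeff (n + 1) =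
      c * p.coeff (n + 1) + d * p.coeff n := by
    intro n
    rw [mul_add, ← mul_assoc, Polynomial.coeff_add, Polynomial.coeff_mul_X,
      Polynomial.coeff_mul_C, Polynomial.coeff_mul_C]
    ring
  refine ⟨fun n => ?_, fun m n hmn => ?_⟩
  · rcases n with _ | n
    · rw [z]; exact mul_nonneg hc (h0 _)
    · rw [s]; exact add_nonneg (mul_nonneg hc (h0 _)) (mul_nonneg hd (h0 _))
  · generalize p.coeff = a at *
    have hcd := mul_nonneg hc hd
    rcases m with _ | k
    · rw [z, s, s, s]
      have t1 := mul_le_mul_of_nonneg_left (h 0 n (Nat.zero_le _)) (mul_nonneg hc hc)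
      have t2 := mul_nonneg (mul_nonneg hc hd) (mul_nonneg (h0 1) (h0 n))
      have t3 := mul_nonneg (mul_nonneg hd hd) (mul_nonneg (h0 0) (h0 n))
      simp only [Nat.zero_add] at *
      linarith
    · obtain ⟨l, rfl⟩ : ∃ l, n = l + 1 := ⟨n - 1, by omega⟩
      have hkl : k ≤ l := by omega
      rw [s, s, s, s]
      have t1 := mul_le_mul_of_nonneg_left (h (k + 1) (l + 1) hmn) (mul_nonneg hc hc)
      have t2 := mul_le_mul_of_nonneg_left (h k l hkl) (mul_nonneg hd hd)
      have t3 : a k * a (l + 3) ≤ a (k + 2) * a (l + 1) := by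
        rcases hkl.eq_or_lt with rfl | hlt
        · exact (h k (k + 1) (by omega)).trans_eq (mul_comm _ _)
        · exact (h k (l + 1) (by omega)).trans (h (k + 1) l (by omega))
      have t4 := mul_le_mul_of_nonneg_left t3 hcd
      linarith

theorem LogConcaveSeq.coeff_mul_linear_pow {p : Polynomial ℝ} (hp : LogConcaveSeq p.coeff)
    {c d : ℝ} (hc : 0 ≤ c) (hd : 0 ≤ d) (n : ℕ) :
    LogConcaveSeq (p * (Polynomial.C c + Polynomial.C d * Polynomial.X) ^ n).coeff := by
  induction n with
  | zero => simpa using hp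
  | succ n ih => rw [pow_succ, ← mul_assoc]; exact ih.coeff_mul_linear hc hd

theorem coeff_mul_linear_pow_pos {p : Polynomial ℝ} (hp : LogConcaveSeq p.coeff) {l : ℕ}
    (hpos : ∀ k ≤ l, 0 < p.coeff k) {c d : ℝ} (hc : 0 < c) (hd : 0 < d) (n : ℕ) :
    ∀ k ≤ l + n, 0 < (p * (Polynomial.C c + Polynomial.C d * Polynomial.X) ^ n).coeff k := by
  induction n with
  | zero => simpa using hpos
  | succ n ih =>
    have h0 := (hp.coeff_mul_linear_pow hc.le hd.le n).1
    intro k hk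
    rw [pow_succ, ← mul_assoc]
    generalize p * (Polynomial.C c + Polynomial.C d * Polynomial.X) ^ n = q at *
    rcases k with _ | k
    · simpa using mul_pos (ih 0 (Nat.zero_le _)) hc
    · rw [mul_add, ← mul_assoc, Polynomial.coeff_add, Polynomial.coeff_mul_X,
        Polynomial.coeff_mul_C, Polynomial.coeff_mul_C]
      exact add_pos_of_nonneg_of_pos (mul_nonneg (h0 _) hc.le)
        (mul_pos (ih k (by omega)) hd)

/-- Every index of a log-concave sequence is a mode of a suitable exponential tilt. -/
theorem LogConcaveSeq.exists_tilt {a : ℕ → ℝ} (ha : LogConcaveSeq a) {n : ℕ} (hn : n ≠ 0)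
    (hpos : ∀ k ≤ n, 0 < a k) {j : ℕ} (hj : j ≤ n) :
    ∃ s : ℝ, 0 < s ∧ ∀ k ≤ n, a k * s ^ k ≤ a j * s ^ j := by
  have key : ∀ j, j + 1 ≤ n → 0 < a j / a (j + 1) ∧
      ∀ k ≤ n, a k * (a j / a (j + 1)) ^ k ≤ a j * (a j / a (j + 1)) ^ j := by
    intro j hj
    have p1 := hpos j (by omega)
    have p2 := hpos (j + 1) hj
    have hs : 0 < a j / a (j + 1) := div_pos p1 p2
    refine ⟨hs, ?_⟩
    set s := a j / a (j + 1) with hsdef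
    have hsj : s * a (j + 1) = a j := by rw [hsdef]; field_simp
    have up : ∀ k, j ≤ k → a k * s ^ k ≤ a j * s ^ j := by
      intro k hk
      induction k, hk using Nat.le_induction with
      | base => exact le_rfl
      | succ k hk ih =>
        refine le_trans ?_ ih
        have h1 : a (k + 1) * s ≤ a k := by
          rw [hsdef, ← mul_div_assoc, div_le_iff₀ p2]
          rcases hk.eq_or_lt with rfl | hlt
          · rw [mul_comm]
          · obtain ⟨l, rfl⟩ : ∃ l, k = l + 1 := ⟨k - 1, by omega⟩
            have := ha.2 j l (by omega)
            linarith
        calc a (k + 1) * s ^ (k + 1) = (a (k + 1) * s) * s ^ k := by ring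
          _ ≤ a k * s ^ k := mul_le_mul_of_nonneg_right h1 (pow_nonneg hs.le _)
    have down : ∀ m, ∀ k, k + m = j → a k * s ^ k ≤ a j * s ^ j := by
      intro m
      induction m with
      | zero => rintro k rfl; exact le_rfl
      | succ m ih =>
        intro k hk
        refine le_trans ?_ (ih (k + 1) (by omega))
        have h1 : a k ≤ a (k + 1) * s := by
          rw [hsdef, ← mul_div_assoc, le_div_iff₀ p2]
          obtain ⟨l, rfl⟩ : ∃ l, j = l + 1 := ⟨j - 1, by omega⟩
          exact ha.2 k l (by omega)
        calc a k * s ^ k ≤ (a (k + 1) * s) * s ^ k :=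
              mul_le_mul_of_nonneg_right h1 (pow_nonneg hs.le _)
          _ = a (k + 1) * s ^ (k + 1) := by ring
    intro k _
    rcases le_total j k with h | h
    · exact up k h
    · exact down (j - k) k (by omega)
  rcases hj.eq_or_lt with rfl | hlt
  · obtain ⟨m, rfl⟩ : ∃ m, j = m + 1 := ⟨j - 1, by omega⟩
    obtain ⟨h1, h2⟩ := key m le_rfl
    refine ⟨_, h1, fun k hk => (h2 k hk).trans_eq ?_⟩
    have p2 := (hpos (m + 1) le_rfl).ne'
    rw [pow_succ]; field_simp
  · exact ⟨_, key j hlt⟩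

/-! ## Large deviation bounds for the transition probabilities -/

/-- The generating polynomial of the transition probabilities. -/
theorem spinTransition_eq_coeff {N : ℕ} (hN : N ≠ 0) (T : ℝ) (i j : Fin (2 * N + 1)) :
    spinTransition N T i j =
      ((1 * (Polynomial.C ((1 - Real.exp (-2 * T)) / 2) +
          Polynomial.C ((1 + Real.exp (-2 * T)) / 2) * Polynomial.X) ^ (i : ℕ)) *
        (Polynomial.C ((1 + Real.exp (-2 * T)) / 2) +
          Polynomial.C ((1 - Real.exp (-2 * T)) / 2) * Polynomial.X) ^ (2 * N - i)).coeff j := by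
  set r := Real.exp (-2 * T)
  have hp : (∑ k : Fin (2 * N + 1), Polynomial.C (spinTransition N T i k) * Polynomial.X ^ (k : ℕ)) =
      (1 * (Polynomial.C ((1 - r) / 2) + Polynomial.C ((1 + r) / 2) * Polynomial.X) ^ (i : ℕ)) *
      (Polynomial.C ((1 + r) / 2) + Polynomial.C ((1 - r) / 2) * Polynomial.X) ^ (2 * N - i) := by
    refine Polynomial.eq_of_infinite_eval_eq _ _ ((Set.Ioi_infinite (0 : ℝ)).mono fun s hs => ?_)
    have hs' : 0 < s + 1 := by have := Set.mem_Ioi.1 hs; linarith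
    have h := sum_spinTransition_mul_spinWeight hN T ((s - 1) / (s + 1)) i
    change _ = spinWeight N (r * _) i at h
    have e1 : 1 + (s - 1) / (s + 1) = 2 / (s + 1) * s := by field_simp; ring
    have e2 : 1 - (s - 1) / (s + 1) = 2 / (s + 1) := by field_simp; ring
    have e3 : 1 + r * ((s - 1) / (s + 1)) = 2 / (s + 1) * ((1 - r) / 2 + (1 + r) / 2 * s) := by
      field_simp; ring
    have e4 : 1 - r * ((s - 1) / (s + 1)) = 2 / (s + 1) * ((1 + r) / 2 + (1 - r) / 2 * s) := by
      field_simp; ring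
    have hpow : ∀ k : Fin (2 * N + 1), (2 / (s + 1)) ^ (2 * N) =
        (2 / (s + 1)) ^ (k : ℕ) * (2 / (s + 1)) ^ (2 * N - k) := by
      intro k
      rw [← pow_add]; congr 1; omega
    have h2 : (2 / (s + 1)) ^ (2 * N) * ∑ k, spinTransition N T i k * s ^ (k : ℕ) =
        (2 / (s + 1)) ^ (2 * N) * (((1 - r) / 2 + (1 + r) / 2 * s) ^ (i : ℕ) *
          ((1 + r) / 2 + (1 - r) / 2 * s) ^ (2 * N - i)) := by
      simp only [spinWeight, e1, e2, e3, e4, mul_pow] at h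
      rw [Finset.mul_sum]
      rw [hpow i]
      calc _ = _ := Finset.sum_congr rfl fun k _ => by rw [← hpow i, hpow k]; ring
        _ = _ := h
        _ = _ := by ring
    have h3 := mul_left_cancel₀ (by positivity) h2
    simp only [Set.mem_ofPred_eq, Polynomial.eval_finsetSum, Polynomial.eval_mul,
      Polynomial.eval_pow, Polynomial.eval_C, Polynomial.eval_X, Polynomial.eval_add,
      one_mul]
    exact h3
  rw [← hp, Polynomial.finsetSum_coeff]
  simp only [Polynomial.coeff_C_mul_X_pow]
  rw [Finset.sum_eq_single j]
  · simp
  · intro k _ hk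
    rw [if_neg]
    exact fun h => hk (Fin.ext h.symm)
  · simp

theorem exp_neg_two_mul_mem {T : ℝ} (hT : 0 < T) :
    0 < Real.exp (-2 * T) ∧ Real.exp (-2 * T) < 1 :=
  ⟨Real.exp_pos _, Real.exp_lt_one_iff.2 (by linarith)⟩

theorem spinTransition_pos {N : ℕ} (hN : N ≠ 0) {T : ℝ} (hT : 0 < T) (i j : Fin (2 * N + 1)) :
    0 < spinTransition N T i j := by
  obtain ⟨r0, r1⟩ := exp_neg_two_mul_mem hT
  have h1 : LogConcaveSeq (1 : Polynomial ℝ).coeff := by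
    refine ⟨fun n => ?_, fun m n _ => ?_⟩ <;> simp [Polynomial.coeff_one]
    split_ifs <;> norm_num
  rw [spinTransition_eq_coeff hN T i j]
  refine coeff_mul_linear_pow_pos (l := (i : ℕ)) (h1.coeff_mul_linear_pow ?_ ?_ _) ?_ ?_ ?_ _ _ ?_
  any_goals linarith
  · have := coeff_mul_linear_pow_pos h1 (l := 0) (by simp) (c := (1 - Real.exp (-2 * T)) / 2)
      (d := (1 + Real.exp (-2 * T)) / 2) (by linarith) (by linarith) i
    simpa using this
  · omega

theorem exists_tilt_spinTransition {N : ℕ} (hN : N ≠ 0) {T : ℝ} (hT : 0 < T)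
    (i j : Fin (2 * N + 1)) :
    ∃ s : ℝ, 0 < s ∧ ∀ k : Fin (2 * N + 1),
      spinTransition N T i k * s ^ (k : ℕ) ≤ spinTransition N T i j * s ^ (j : ℕ) := by
  obtain ⟨r0, r1⟩ := exp_neg_two_mul_mem hT
  have h1 : LogConcaveSeq (1 : Polynomial ℝ).coeff := by
    refine ⟨fun n => ?_, fun m n _ => ?_⟩ <;> simp [Polynomial.coeff_one]
    split_ifs <;> norm_num
  have h2 := (h1.coeff_mul_linear_pow (c := (1 - Real.exp (-2 * T)) / 2)
    (d := (1 + Real.exp (-2 * T)) / 2) (by linarith) (by linarith) i).coeff_mul_linear_pow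
    (c := (1 + Real.exp (-2 * T)) / 2) (d := (1 - Real.exp (-2 * T)) / 2)
    (by linarith) (by linarith) (2 * N - i)
  obtain ⟨s, hs, h⟩ := h2.exists_tilt (n := 2 * N) (by omega) (fun k hk => by
    have := spinTransition_pos hN hT i ⟨k, by omega⟩
    rwa [spinTransition_eq_coeff hN T] at this) (j := j) (by omega)
  refine ⟨s, hs, fun k => ?_⟩
  rw [spinTransition_eq_coeff hN T, spinTransition_eq_coeff hN T]
  exact h k (by omega)

/-- The value at parameter `w` of the dual problem whose supremum is the cost of moving from `x`
to `b` during a time `T` with `r = e⁻²ᵀ`. -/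
noncomputable def dualValue (r x b w : ℝ) : ℝ :=
  (1 + b) * Real.log (1 + w) + (1 - b) * Real.log (1 - w) -
    ((1 + x) * Real.log (1 + r * w) + (1 - x) * Real.log (1 - r * w))

theorem abs_mul_lt_one {r w : ℝ} (r0 : 0 < r) (r1 : r < 1) (hw : w ∈ Set.Icc (-1 : ℝ) 1) :
    0 < 1 + r * w ∧ 0 < 1 - r * w := by
  constructor <;> nlinarith [hw.1, hw.2]

theorem spinWeight_eq_exp {N : ℕ} (hN : N ≠ 0) {w : ℝ} (h1 : 0 < 1 + w) (h2 : 0 < 1 - w)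
    (i : Fin (2 * N + 1)) :
    spinWeight N w i =
      Real.exp (N * ((1 + site N i) * Real.log (1 + w) + (1 - site N i) * Real.log (1 - w))) := by
  have hN' : (N : ℝ) ≠ 0 := by exact_mod_cast hN
  have e1 : (N : ℝ) * (1 + site N i) = (i : ℕ) := by simp only [site]; field_simp; ring
  have e2 : (N : ℝ) * (1 - site N i) = (2 * N - i : ℕ) := by
    rw [Nat.cast_sub (by omega)]
    simp only [site]; push_cast; field_simp; ring
  rw [mul_add, ← mul_assoc, ← mul_assoc, e1, e2, Real.exp_add, Real.exp_nat_mul, Real.exp_nat_mul,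
    Real.exp_log h1, Real.exp_log h2, spinWeight]

theorem exp_neg_dualValue {N : ℕ} (hN : N ≠ 0) {T : ℝ} (hT : 0 < T) {w : ℝ}
    (hw : w ∈ Set.Ioo (-1 : ℝ) 1) (i j : Fin (2 * N + 1)) :
    Real.exp (-(N * dualValue (Real.exp (-2 * T)) (site N i) (site N j) w)) * spinWeight N w j =
      spinWeight N (Real.exp (-2 * T) * w) i := by
  obtain ⟨r0, r1⟩ := exp_neg_two_mul_mem hT
  obtain ⟨h1, h2⟩ := abs_mul_lt_one r0 r1 (Set.Ioo_subset_Icc_self hw)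
  rw [spinWeight_eq_exp hN (by linarith [hw.1]) (by linarith [hw.2]), spinWeight_eq_exp hN h1 h2,
    ← Real.exp_add, dualValue]
  congr 1; ring

theorem spinWeight_pos {N : ℕ} {w : ℝ} (hw : w ∈ Set.Ioo (-1 : ℝ) 1) (j : ℕ) :
    0 < spinWeight N w j :=
  mul_pos (pow_pos (by linarith [hw.1]) _) (pow_pos (by linarith [hw.2]) _)

theorem spinTransition_le {N : ℕ} (hN : N ≠ 0) {T : ℝ} (hT : 0 < T) {w : ℝ}
    (hw : w ∈ Set.Ioo (-1 : ℝ) 1) (i j : Fin (2 * N + 1)) :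
    spinTransition N T i j ≤
      Real.exp (-(N * dualValue (Real.exp (-2 * T)) (site N i) (site N j) w)) := by
  have hv := fun k : ℕ => spinWeight_pos (N := N) hw k
  refine le_of_mul_le_mul_right ?_ (hv j)
  rw [exp_neg_dualValue hN hT hw, ← sum_spinTransition_mul_spinWeight hN]
  exact Finset.single_le_sum (f := fun k : Fin (2 * N + 1) =>
    spinTransition N T i k * spinWeight N w k)
    (fun k _ => mul_nonneg (spinTransition_pos hN hT i k).le (hv k).le) (Finset.mem_univ j)

theorem exists_le_spinTransition {N : ℕ} (hN : N ≠ 0) {T : ℝ} (hT : 0 < T)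
    (i j : Fin (2 * N + 1)) :
    ∃ w ∈ Set.Ioo (-1 : ℝ) 1,
      Real.exp (-(N * dualValue (Real.exp (-2 * T)) (site N i) (site N j) w)) ≤
        (2 * N + 1) * spinTransition N T i j := by
  obtain ⟨s, hs, h⟩ := exists_tilt_spinTransition hN hT i j
  have hs' : 0 < s + 1 := by linarith
  have hw : (s - 1) / (s + 1) ∈ Set.Ioo (-1 : ℝ) 1 := by
    constructor
    · rw [lt_div_iff₀ hs']; linarith
    · rw [div_lt_iff₀ hs']; linarith
  refine ⟨_, hw, ?_⟩
  have e1 : 1 + (s - 1) / (s + 1) = 2 / (s + 1) * s := by field_simp; ring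
  have e2 : 1 - (s - 1) / (s + 1) = 2 / (s + 1) := by field_simp; ring
  have hsw : ∀ k : Fin (2 * N + 1), spinWeight N ((s - 1) / (s + 1)) k =
      (2 / (s + 1)) ^ (2 * N) * s ^ (k : ℕ) := by
    intro k
    rw [spinWeight, e1, e2, mul_pow, mul_right_comm, ← pow_add]
    congr 2; omega
  refine le_of_mul_le_mul_right ?_ (spinWeight_pos (N := N) hw j)
  rw [exp_neg_dualValue hN hT hw, ← sum_spinTransition_mul_spinWeight hN]
  calc ∑ k, spinTransition N T i k * spinWeight N ((s - 1) / (s + 1)) k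
      ≤ ∑ k : Fin (2 * N + 1), spinTransition N T i j * spinWeight N ((s - 1) / (s + 1)) j := by
        refine Finset.sum_le_sum fun k _ => ?_
        rw [hsw, hsw, mul_left_comm, mul_left_comm (spinTransition N T i j)]
        exact mul_le_mul_of_nonneg_left (h k) (by positivity)
    _ = _ := by simp; ring

/-! ## The Lagrangian along a path -/

/-- The running value `c e²ᵗ` of the hyperbolic tangent of half the momentum. -/
noncomputable def tanhMomentum (c t : ℝ) : ℝ := c * Real.exp (2 * t)

/-- The momentum whose half has hyperbolic tangent `w`. -/
noncomputable def momentum (w : ℝ) : ℝ := Real.log (1 + w) - Real.log (1 - w)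

theorem exp_momentum {w : ℝ} (hw : |w| < 1) : Real.exp (momentum w) = (1 + w) / (1 - w) := by
  rw [abs_lt] at hw
  rw [momentum, Real.exp_sub, Real.exp_log (by linarith), Real.exp_log (by linarith)]

theorem exp_neg_momentum {w : ℝ} (hw : |w| < 1) :
    Real.exp (-momentum w) = (1 - w) / (1 + w) := by
  rw [Real.exp_neg, exp_momentum hw, inv_div]

/-- The integrand `p v - H(x, p)` of the dual problem, with `p = momentum w`. -/
noncomputable def dualDensity (w x v : ℝ) : ℝ :=
  momentum w * v - hamiltonian spinBirth spinDeath x (momentum w)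

/-- The primitive of the dual integrand along a path. -/
noncomputable def dualPrimitive (w x : ℝ) : ℝ :=
  (1 + x) * Real.log (1 + w) + (1 - x) * Real.log (1 - w)

theorem hasDerivAt_tanhMomentum (c t : ℝ) :
    HasDerivAt (tanhMomentum c) (2 * tanhMomentum c t) t := by
  have := (((hasDerivAt_id t).const_mul 2).exp).const_mul c
  convert! this using 1
  simp [tanhMomentum]; ring

theorem hasDerivAt_dualPrimitive {γ : ℝ → ℝ} {c t v : ℝ} (hγ : HasDerivAt γ v t)
    (hw : |tanhMomentum c t| < 1) :
    HasDerivAt (fun s => dualPrimitive (tanhMomentum c s) (γ s))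
      (dualDensity (tanhMomentum c t) (γ t) v) t := by
  have hW := hasDerivAt_tanhMomentum c t
  obtain ⟨h1, h2⟩ := abs_lt.1 hw
  have e1 : 1 + tanhMomentum c t ≠ 0 := by linarith
  have e2 : 1 - tanhMomentum c t ≠ 0 := by linarith
  have h := ((hγ.const_add 1).fun_mul ((hW.const_add 1).log e1)).fun_add
    ((hγ.const_sub 1).fun_mul ((hW.const_sub 1).log e2))
  convert! h using 1
  simp only [dualDensity, hamiltonian, exp_momentum hw, exp_neg_momentum hw, spinBirth,
    spinDeath]
  rw [momentum]
  field_simp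
  ring

theorem contDiffOn_log_tanhMomentum {c a b : ℝ}
    (hw : ∀ t ∈ Set.uIcc a b, |tanhMomentum c t| < 1) :
    ContDiffOn ℝ 1 (fun t => Real.log (1 + tanhMomentum c t)) (Set.uIcc a b) ∧
    ContDiffOn ℝ 1 (fun t => Real.log (1 - tanhMomentum c t)) (Set.uIcc a b) := by
  have h : ContDiff ℝ 1 (tanhMomentum c) := by unfold tanhMomentum; fun_prop
  constructor
  · refine ContDiffOn.log (contDiff_const.add h).contDiffOn fun t ht => ?_
    have := abs_lt.1 (hw t ht); linarith
  · refine ContDiffOn.log (contDiff_const.sub h).contDiffOn fun t ht => ?_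
    have := abs_lt.1 (hw t ht); linarith

theorem absolutelyContinuousOnInterval_const (k a b : ℝ) :
    AbsolutelyContinuousOnInterval (fun _ => k) a b :=
  (contDiff_const (n := 1)).contDiffOn.absolutelyContinuousOnInterval

theorem absolutelyContinuousOnInterval_dualPrimitive {γ : ℝ → ℝ} {c a b : ℝ}
    (hγ : AbsolutelyContinuousOnInterval γ a b)
    (hw : ∀ t ∈ Set.uIcc a b, |tanhMomentum c t| < 1) :
    AbsolutelyContinuousOnInterval (fun s => dualPrimitive (tanhMomentum c s) (γ s)) a b := by
  obtain ⟨h1, h2⟩ := contDiffOn_log_tanhMomentum hw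
  exact (((absolutelyContinuousOnInterval_const 1 a b).fun_add hγ).fun_mul
    h1.absolutelyContinuousOnInterval).fun_add
    (((absolutelyContinuousOnInterval_const 1 a b).fun_sub hγ).fun_mul
    h2.absolutelyContinuousOnInterval)

theorem integral_dualDensity {γ : ℝ → ℝ} {c T : ℝ} (hT : 0 ≤ T)
    (hγ : AbsolutelyContinuousOnInterval γ 0 T)
    (hw : ∀ t ∈ Set.Icc 0 T, |tanhMomentum c t| < 1) :
    IntegrableOn (fun t => dualDensity (tanhMomentum c t) (γ t) (deriv γ t)) (Set.Icc 0 T) ∧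
    ∫ t in Set.Icc 0 T, dualDensity (tanhMomentum c t) (γ t) (deriv γ t) =
      dualPrimitive (tanhMomentum c T) (γ T) - dualPrimitive (tanhMomentum c 0) (γ 0) := by
  rw [← Set.uIcc_of_le hT] at hw
  have hG := absolutelyContinuousOnInterval_dualPrimitive hγ hw
  have hae : ∀ᵐ t, t ∈ Set.Icc 0 T →
      deriv (fun s => dualPrimitive (tanhMomentum c s) (γ s)) t =
        dualDensity (tanhMomentum c t) (γ t) (deriv γ t) := by
    filter_upwards [hγ.ae_differentiableAt] with t ht htm
    rw [← Set.uIcc_of_le hT] at htm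
    exact (hasDerivAt_dualPrimitive (ht htm).hasDerivAt (hw t htm)).deriv
  have hae' := (ae_restrict_iff' measurableSet_Icc).2 hae
  have hint := (intervalIntegrable_iff_integrableOn_Icc_of_le hT enorm_ne_top).1
    hG.intervalIntegrable_deriv
  refine ⟨hint.congr hae', ?_⟩
  rw [← integral_congr_ae hae', integral_Icc_eq_integral_Ioc,
    ← intervalIntegral.integral_of_le hT, hG.integral_deriv_eq_sub]

theorem measurable_spinLagrangian : Measurable fun z : ℝ × ℝ => spinLagrangian z.1 z.2 := by
  refine LowerSemicontinuous.measurable (lowerSemicontinuous_iSup fun p => ?_)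
  refine Continuous.lowerSemicontinuous (ENNReal.continuous_ofReal.comp ?_)
  unfold hamiltonian spinBirth spinDeath; fun_prop

theorem aemeasurable_spinLagrangian_path {γ : ℝ → ℝ} {T : ℝ} (hT : 0 ≤ T)
    (hγ : AbsolutelyContinuousOnInterval γ 0 T) :
    AEMeasurable (fun t => spinLagrangian (γ t) (deriv γ t)) (volume.restrict (Set.Icc 0 T)) := by
  have h1 : AEMeasurable γ (volume.restrict (Set.Icc 0 T)) := by
    have := hγ.continuousOn
    rw [Set.uIcc_of_le hT] at this
    exact this.aemeasurable measurableSet_Icc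
  have h2 : AEMeasurable (fun t => (γ t, deriv γ t)) (volume.restrict (Set.Icc 0 T)) :=
    h1.prodMk (measurable_deriv γ).aemeasurable
  have h3 := Measurable.comp_aemeasurable (g := fun z : ℝ × ℝ => spinLagrangian z.1 z.2)
    measurable_spinLagrangian h2
  exact h3

theorem ofReal_le_spinLagrangian (x v p : ℝ) :
    ENNReal.ofReal (p * v - hamiltonian spinBirth spinDeath x p) ≤ spinLagrangian x v :=
  le_iSup (fun p => ENNReal.ofReal (p * v - hamiltonian spinBirth spinDeath x p)) p

theorem le_toReal_spinLagrangian {x v : ℝ} (h : spinLagrangian x v < ∞) (p : ℝ) :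
    p * v - hamiltonian spinBirth spinDeath x p ≤ (spinLagrangian x v).toReal := by
  have := ENNReal.toReal_mono h.ne (ofReal_le_spinLagrangian x v p)
  rw [ENNReal.toReal_ofReal'] at this
  exact (le_max_left _ _).trans this

/-- The gap in the duality between the cost of a path and the dual problem is the integral of a
nonnegative function. -/
theorem integral_sub_dualDensity {γ : ℝ → ℝ} {c T : ℝ} (hT : 0 ≤ T)
    (hγ : AbsolutelyContinuousOnInterval γ 0 T)
    (hfin : ∫⁻ t in Set.Icc 0 T, spinLagrangian (γ t) (deriv γ t) ≠ ∞)
    (hw : ∀ t ∈ Set.Icc 0 T, |tanhMomentum c t| < 1) :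
    ∫⁻ t in Set.Icc 0 T, ENNReal.ofReal ((spinLagrangian (γ t) (deriv γ t)).toReal -
        dualDensity (tanhMomentum c t) (γ t) (deriv γ t)) =
      ENNReal.ofReal ((∫⁻ t in Set.Icc 0 T, spinLagrangian (γ t) (deriv γ t)).toReal -
        (dualPrimitive (tanhMomentum c T) (γ T) - dualPrimitive (tanhMomentum c 0) (γ 0))) ∧
    AEMeasurable (fun t => ENNReal.ofReal ((spinLagrangian (γ t) (deriv γ t)).toReal -
        dualDensity (tanhMomentum c t) (γ t) (deriv γ t))) (volume.restrict (Set.Icc 0 T)) ∧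
    0 ≤ (∫⁻ t in Set.Icc 0 T, spinLagrangian (γ t) (deriv γ t)).toReal -
        (dualPrimitive (tanhMomentum c T) (γ T) - dualPrimitive (tanhMomentum c 0) (γ 0)) := by
  obtain ⟨h1, h2⟩ := integral_dualDensity hT hγ hw
  have hm := aemeasurable_spinLagrangian_path hT hγ
  have hlt := ae_lt_top' hm hfin
  have hint := integrable_toReal_of_lintegral_ne_top hm hfin
  have hnn : 0 ≤ᵐ[volume.restrict (Set.Icc 0 T)] fun t =>
      (spinLagrangian (γ t) (deriv γ t)).toReal -
        dualDensity (tanhMomentum c t) (γ t) (deriv γ t) := by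
    filter_upwards [hlt] with t ht
    exact sub_nonneg.2 (le_toReal_spinLagrangian ht _)
  have heq : ∫ t in Set.Icc 0 T, ((spinLagrangian (γ t) (deriv γ t)).toReal -
      dualDensity (tanhMomentum c t) (γ t) (deriv γ t)) =
      (∫⁻ t in Set.Icc 0 T, spinLagrangian (γ t) (deriv γ t)).toReal -
        (dualPrimitive (tanhMomentum c T) (γ T) - dualPrimitive (tanhMomentum c 0) (γ 0)) := by
    rw [integral_sub hint h1, h2, integral_toReal hm hlt]
  rw [← heq]
  exact ⟨(ofReal_integral_eq_lintegral_ofReal (hint.sub h1) hnn).symm,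
    (hint.sub h1).aestronglyMeasurable.aemeasurable.ennreal_ofReal, integral_nonneg_of_ae hnn⟩

theorem abs_tanhMomentum_lt {w T t : ℝ} (hw : |w| < 1) (ht : t ≤ T) :
    |tanhMomentum (Real.exp (-2 * T) * w) t| < 1 := by
  rw [tanhMomentum, abs_mul, abs_mul, Real.abs_exp, Real.abs_exp, mul_right_comm, ← Real.exp_add]
  have : Real.exp (-2 * T + 2 * t) ≤ 1 := Real.exp_le_one_iff.2 (by linarith)
  nlinarith [abs_nonneg w, Real.exp_pos (-2 * T + 2 * t)]

theorem abs_tanhMomentum_lt_of_lt {w T t : ℝ} (hw : |w| ≤ 1) (ht : t < T) :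
    |tanhMomentum (Real.exp (-2 * T) * w) t| < 1 := by
  rw [tanhMomentum, abs_mul, abs_mul, Real.abs_exp, Real.abs_exp, mul_right_comm, ← Real.exp_add]
  have : Real.exp (-2 * T + 2 * t) < 1 := Real.exp_lt_one_iff.2 (by linarith)
  nlinarith [abs_nonneg w, Real.exp_pos (-2 * T + 2 * t)]

theorem tanhMomentum_end (T w : ℝ) : tanhMomentum (Real.exp (-2 * T) * w) T = w := by
  rw [tanhMomentum, mul_right_comm, ← Real.exp_add]; simp

theorem dualValue_eq_dualPrimitive (T x b w : ℝ) :
    dualValue (Real.exp (-2 * T)) x b w =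
      dualPrimitive (tanhMomentum (Real.exp (-2 * T) * w) T) b -
        dualPrimitive (tanhMomentum (Real.exp (-2 * T) * w) 0) x := by
  rw [tanhMomentum_end]; simp [dualValue, dualPrimitive, tanhMomentum]

/-- Weak duality. -/
theorem ofReal_dualValue_le_lintegral {γ : ℝ → ℝ} {T w : ℝ} (hT : 0 ≤ T)
    (hγ : AbsolutelyContinuousOnInterval γ 0 T) (hw : |w| < 1) :
    ENNReal.ofReal (dualValue (Real.exp (-2 * T)) (γ 0) (γ T) w) ≤
      ∫⁻ t in Set.Icc 0 T, spinLagrangian (γ t) (deriv γ t) := by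
  by_cases hfin : ∫⁻ t in Set.Icc 0 T, spinLagrangian (γ t) (deriv γ t) = ∞
  · rw [hfin]; exact le_top
  have h := (integral_sub_dualDensity hT hγ hfin fun t ht => abs_tanhMomentum_lt hw ht.2).2.2
  rw [← dualValue_eq_dualPrimitive] at h
  exact ENNReal.ofReal_le_of_le_toReal (by linarith)

/-! ## Optimal paths between fixed points -/

/-- The dual parameters at which the dual problem with terminal point `b` is finite. -/
structure DualAdmissible (b w : ℝ) : Prop where
  abs_le_one : |w| ≤ 1
  eq_one : w = 1 → b = 1
  eq_neg_one : w = -1 → b = -1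

/-- The solution of the Hamilton equations that starts at `x` with momentum `momentum c`. -/
noncomputable def hamiltonPath (c x t : ℝ) : ℝ :=
  tanhMomentum c t + (x - c) / (1 - c ^ 2) * (Real.exp (-2 * t) - c ^ 2 * Real.exp (2 * t))

theorem exp_two_mul_pos_inv (t : ℝ) :
    0 < Real.exp (2 * t) ∧ Real.exp (-2 * t) = (Real.exp (2 * t))⁻¹ := by
  refine ⟨Real.exp_pos _, ?_⟩
  rw [neg_mul, Real.exp_neg]

theorem hamiltonPath_zero {c : ℝ} (hc : |c| < 1) (x : ℝ) : hamiltonPath c x 0 = x := by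
  have h : 1 - c ^ 2 ≠ 0 := by
    have := (sq_lt_one_iff_abs_lt_one c).2 hc; linarith
  simp only [hamiltonPath, tanhMomentum, mul_zero, Real.exp_zero, mul_one]
  field_simp
  ring

theorem hasDerivAt_hamiltonPath (c x t : ℝ) :
    HasDerivAt (hamiltonPath c x) (2 * tanhMomentum c t + (x - c) / (1 - c ^ 2) *
      (-2 * Real.exp (-2 * t) - c ^ 2 * (2 * Real.exp (2 * t)))) t := by
  have e1 : HasDerivAt (fun t : ℝ => Real.exp (-2 * t)) (-2 * Real.exp (-2 * t)) t := by
    have := ((hasDerivAt_id t).const_mul (-2)).exp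
    convert! this using 1
    simp; ring
  have e2 : HasDerivAt (fun t : ℝ => Real.exp (2 * t)) (2 * Real.exp (2 * t)) t := by
    have := ((hasDerivAt_id t).const_mul 2).exp
    convert! this using 1
    simp; ring
  exact (hasDerivAt_tanhMomentum c t).add ((e1.sub (e2.const_mul (c ^ 2))).const_mul _)

theorem continuous_hamiltonPath (c x : ℝ) : Continuous (hamiltonPath c x) :=
  continuous_iff_continuousAt.2 fun t => (hasDerivAt_hamiltonPath c x t).continuousAt

/-- The Hamilton equation `dx/dt = ∂H/∂p` in terms of `w = tanh (p / 2)`. -/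
theorem le_dualDensity_of_velocity_eq {w x v : ℝ} (hw : |w| < 1) (hx : x ∈ Set.Icc (-1 : ℝ) 1)
    (hv : v * (1 - w ^ 2) = 4 * w - 2 * x * (1 + w ^ 2)) (q : ℝ) :
    q * v - hamiltonian spinBirth spinDeath x q ≤ dualDensity w x v := by
  have hw' := abs_lt.1 hw
  have h1 : 0 < 1 - w := by linarith
  have h2 : 0 < 1 + w := by linarith
  have hv' : v = Real.exp (momentum w) * (1 - x) - Real.exp (-momentum w) * (1 + x) := by
    rw [exp_momentum hw, exp_neg_momentum hw]
    field_simp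
    linear_combination hv
  simp only [dualDensity, hamiltonian, spinBirth, spinDeath]
  set p := momentum w
  have t1 : Real.exp p * (q - p) ≤ Real.exp q - Real.exp p := by
    have := mul_le_mul_of_nonneg_left (Real.add_one_le_exp (q - p)) (Real.exp_pos p).le
    rw [← Real.exp_add, add_sub_cancel] at this
    linarith
  have t2 : Real.exp (-p) * (p - q) ≤ Real.exp (-q) - Real.exp (-p) := by
    have := mul_le_mul_of_nonneg_left (Real.add_one_le_exp (p - q)) (Real.exp_pos (-p)).le
    rw [← Real.exp_add, show -p + (p - q) = -q by ring] at this
    linarith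
  have t3 := mul_le_mul_of_nonneg_right t1 (show 0 ≤ 1 - x by linarith [hx.2])
  have t4 := mul_le_mul_of_nonneg_right t2 (show 0 ≤ 1 + x by linarith [hx.1])
  rw [hv']
  linarith

theorem velocity_eq_of_dualDensity_max {w x v : ℝ} (hw : |w| < 1)
    (h : ∀ q, q * v - hamiltonian spinBirth spinDeath x q ≤ dualDensity w x v) :
    v * (1 - w ^ 2) = 4 * w - 2 * x * (1 + w ^ 2) := by
  have hw' := abs_lt.1 hw
  have h1 : 0 < 1 - w := by linarith
  have h2 : 0 < 1 + w := by linarith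
  have hmax : IsLocalMax (fun q => q * v - hamiltonian spinBirth spinDeath x q) (momentum w) :=
    Eventually.of_forall h
  have hd : HasDerivAt (fun q => q * v - hamiltonian spinBirth spinDeath x q)
      (v - (Real.exp (momentum w) * (1 - x) - Real.exp (-momentum w) * (1 + x))) (momentum w) := by
    simp only [hamiltonian, spinBirth, spinDeath]
    have e1 := ((Real.hasDerivAt_exp (momentum w)).sub_const 1).mul_const (1 - x)
    have e2 := (((hasDerivAt_neg (momentum w)).exp).sub_const 1).mul_const (1 + x)
    have := ((hasDerivAt_id (momentum w)).mul_const v).sub (e1.add e2)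
    convert! this using 1
    ring
  have h0 := hmax.hasDerivAt_eq_zero hd
  rw [exp_momentum hw, exp_neg_momentum hw] at h0
  field_simp at h0
  linear_combination h0

theorem hamiltonPath_velocity {c x t : ℝ} :
    (2 * tanhMomentum c t + (x - c) / (1 - c ^ 2) *
      (-2 * Real.exp (-2 * t) - c ^ 2 * (2 * Real.exp (2 * t)))) * (1 - tanhMomentum c t ^ 2) =
    4 * tanhMomentum c t - 2 * hamiltonPath c x t * (1 + tanhMomentum c t ^ 2) := by
  obtain ⟨h1, h2⟩ := exp_two_mul_pos_inv t
  simp only [hamiltonPath, tanhMomentum, h2]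
  generalize (x - c) / (1 - c ^ 2) = K
  field_simp
  ring

theorem one_add_hamiltonPath (c x t : ℝ) :
    1 + hamiltonPath c x t = (1 + tanhMomentum c t) *
      (1 + (x - c) / (1 - c ^ 2) * (Real.exp (-2 * t) - c)) := by
  obtain ⟨h1, h2⟩ := exp_two_mul_pos_inv t
  simp only [hamiltonPath, tanhMomentum, h2]
  generalize (x - c) / (1 - c ^ 2) = K
  field_simp
  ring

theorem one_sub_hamiltonPath (c x t : ℝ) :
    1 - hamiltonPath c x t = (1 - tanhMomentum c t) *
      (1 - (x - c) / (1 - c ^ 2) * (Real.exp (-2 * t) + c)) := by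
  obtain ⟨h1, h2⟩ := exp_two_mul_pos_inv t
  simp only [hamiltonPath, tanhMomentum, h2]
  generalize (x - c) / (1 - c ^ 2) = K
  field_simp
  ring

theorem hamiltonPath_mem {c x t : ℝ} (hx : x ∈ Set.Icc (-1 : ℝ) 1) (hc : |c| < 1) (ht : 0 ≤ t)
    (hw : |tanhMomentum c t| ≤ 1) : hamiltonPath c x t ∈ Set.Icc (-1 : ℝ) 1 := by
  obtain ⟨c1, c2⟩ := abs_lt.1 hc
  obtain ⟨w1, w2⟩ := abs_le.1 hw
  have hd : 0 < 1 - c ^ 2 := by nlinarith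
  have hle : Real.exp (-2 * t) ≤ 1 := Real.exp_le_one_iff.2 (by linarith)
  obtain ⟨h1, h2⟩ := exp_two_mul_pos_inv t
  have hW : c = tanhMomentum c t * Real.exp (-2 * t) := by
    rw [tanhMomentum, h2]; field_simp
  have he := Real.exp_pos (-2 * t)
  have k1 : 0 ≤ 1 + (x - c) / (1 - c ^ 2) * (Real.exp (-2 * t) - c) := by
    have h3 : 0 ≤ Real.exp (-2 * t) - c := by nlinarith
    have h4 : -1 ≤ (x - c) * (Real.exp (-2 * t) - c) / (1 - c ^ 2) := by
      rw [le_div_iff₀ hd]; nlinarith [hx.1]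
    rw [div_mul_eq_mul_div]; linarith
  have k2 : 0 ≤ 1 - (x - c) / (1 - c ^ 2) * (Real.exp (-2 * t) + c) := by
    rw [div_mul_eq_mul_div, sub_nonneg, div_le_one hd]
    have : 0 ≤ Real.exp (-2 * t) + c := by nlinarith
    nlinarith [hx.2]
  have m1 := mul_nonneg (show 0 ≤ 1 + tanhMomentum c t by linarith) k1
  have m2 := mul_nonneg (show 0 ≤ 1 - tanhMomentum c t by linarith) k2
  rw [← one_add_hamiltonPath] at m1
  rw [← one_sub_hamiltonPath] at m2
  constructor <;> linarith

theorem continuous_dualPrimitive_hamiltonPath (c x : ℝ) :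
    Continuous fun t => dualPrimitive (tanhMomentum c t) (hamiltonPath c x t) := by
  have hW : Continuous (tanhMomentum c) := by unfold tanhMomentum; fun_prop
  have h1 : Continuous fun t => (1 + tanhMomentum c t) * Real.log (1 + tanhMomentum c t) :=
    Real.continuous_mul_log.comp (continuous_const.add hW)
  have h2 : Continuous fun t => (1 - tanhMomentum c t) * Real.log (1 - tanhMomentum c t) :=
    Real.continuous_mul_log.comp (continuous_const.sub hW)
  have h3 : Continuous fun t => 1 + (x - c) / (1 - c ^ 2) * (Real.exp (-2 * t) - c) := by fun_prop
  have h4 : Continuous fun t => 1 - (x - c) / (1 - c ^ 2) * (Real.exp (-2 * t) + c) := by fun_prop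
  refine ((h1.fun_mul h3).fun_add (h2.fun_mul h4)).congr fun t => ?_
  simp only [dualPrimitive, one_add_hamiltonPath, one_sub_hamiltonPath]
  ring

theorem spinLagrangian_eq_dualDensity {w x v : ℝ} (hw : |w| < 1) (hx : x ∈ Set.Icc (-1 : ℝ) 1)
    (hv : v * (1 - w ^ 2) = 4 * w - 2 * x * (1 + w ^ 2)) :
    spinLagrangian x v = ENNReal.ofReal (dualDensity w x v) ∧ 0 ≤ dualDensity w x v := by
  have h := le_dualDensity_of_velocity_eq hw hx hv
  refine ⟨le_antisymm (iSup_le fun q => ENNReal.ofReal_le_ofReal (h q))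
    (ofReal_le_spinLagrangian _ _ _), ?_⟩
  simpa [hamiltonian] using h 0

theorem lintegral_spinLagrangian_hamiltonPath {T w x : ℝ} (hT : 0 < T) (hw : |w| ≤ 1)
    (hx : x ∈ Set.Icc (-1 : ℝ) 1) :
    ∫⁻ t in Set.Icc 0 T, spinLagrangian (hamiltonPath (Real.exp (-2 * T) * w) x t)
        (deriv (hamiltonPath (Real.exp (-2 * T) * w) x) t) =
      ENNReal.ofReal (dualValue (Real.exp (-2 * T)) x
        (hamiltonPath (Real.exp (-2 * T) * w) x T) w) ∧
    0 ≤ dualValue (Real.exp (-2 * T)) x (hamiltonPath (Real.exp (-2 * T) * w) x T) w := by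
  set c := Real.exp (-2 * T) * w with hcdef
  have hW : ∀ t < T, |tanhMomentum c t| < 1 := fun t ht => abs_tanhMomentum_lt_of_lt hw ht
  have hc : |c| < 1 := by simpa [tanhMomentum] using hW 0 hT
  have hd : ∀ t, HasDerivAt (hamiltonPath c x) (deriv (hamiltonPath c x) t) t := fun t =>
    (hasDerivAt_hamiltonPath c x t).differentiableAt.hasDerivAt
  have key : ∀ t ∈ Set.Ioo 0 T, spinLagrangian (hamiltonPath c x t) (deriv (hamiltonPath c x) t) =
      ENNReal.ofReal (dualDensity (tanhMomentum c t) (hamiltonPath c x t)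
        (deriv (hamiltonPath c x) t)) ∧
      0 ≤ dualDensity (tanhMomentum c t) (hamiltonPath c x t) (deriv (hamiltonPath c x) t) := by
    intro t ht
    refine spinLagrangian_eq_dualDensity (hW t ht.2)
      (hamiltonPath_mem hx hc ht.1.le (hW t ht.2).le) ?_
    rw [(hasDerivAt_hamiltonPath c x t).deriv, hamiltonPath_velocity]
  have hcont : ContinuousOn (fun t => dualPrimitive (tanhMomentum c t) (hamiltonPath c x t))
      (Set.Icc 0 T) := (continuous_dualPrimitive_hamiltonPath c x).continuousOn
  have hder : ∀ t ∈ Set.Ioo 0 T,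
      HasDerivAt (fun t => dualPrimitive (tanhMomentum c t) (hamiltonPath c x t))
      (dualDensity (tanhMomentum c t) (hamiltonPath c x t) (deriv (hamiltonPath c x) t)) t :=
    fun t ht => hasDerivAt_dualPrimitive (hd t) (hW t ht.2)
  have hint := intervalIntegral.integrableOn_deriv_of_nonneg hcont hder fun t ht => (key t ht).2
  have hI := intervalIntegral.integral_eq_sub_of_hasDerivAt_of_le hT.le hcont hder
    ((intervalIntegrable_iff_integrableOn_Ioc_of_le hT.le).2 hint)
  rw [intervalIntegral.integral_of_le hT.le, integral_Ioc_eq_integral_Ioo] at hI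
  have hval : dualValue (Real.exp (-2 * T)) x (hamiltonPath c x T) w =
      dualPrimitive (tanhMomentum c T) (hamiltonPath c x T) -
        dualPrimitive (tanhMomentum c 0) (hamiltonPath c x 0) := by
    rw [hamiltonPath_zero hc, dualValue_eq_dualPrimitive]
  rw [hval, ← hI]
  have hnn : 0 ≤ᵐ[volume.restrict (Set.Ioo 0 T)] fun t =>
      dualDensity (tanhMomentum c t) (hamiltonPath c x t) (deriv (hamiltonPath c x) t) :=
    (ae_restrict_iff' measurableSet_Ioo).2 (Eventually.of_forall fun t ht => (key t ht).2)
  refine ⟨?_, integral_nonneg_of_ae hnn⟩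
  rw [ofReal_integral_eq_lintegral_ofReal (hint.mono_set Set.Ioo_subset_Ioc_self) hnn,
    ← restrict_Ioo_eq_restrict_Icc]
  exact setLIntegral_congr_fun measurableSet_Ioo fun t ht => (key t ht).1

theorem isPathTo_hamiltonPath {T w x b : ℝ} (hT : 0 < T) (hw : |w| ≤ 1)
    (hx : x ∈ Set.Icc (-1 : ℝ) 1) (hb : hamiltonPath (Real.exp (-2 * T) * w) x T = b) :
    IsPathTo T b (hamiltonPath (Real.exp (-2 * T) * w) x) := by
  have hW : ∀ t < T, |tanhMomentum (Real.exp (-2 * T) * w) t| < 1 :=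
    fun t ht => abs_tanhMomentum_lt_of_lt hw ht
  have hc : |Real.exp (-2 * T) * w| < 1 := by simpa [tanhMomentum] using hW 0 hT
  refine ⟨ContDiffOn.absolutelyContinuousOnInterval ?_, fun t ht => ?_, hb⟩
  · refine ContDiff.contDiffOn ?_
    unfold hamiltonPath tanhMomentum; fun_prop
  · refine hamiltonPath_mem hx hc ht.1 ?_
    rcases ht.2.lt_or_eq with h | rfl
    · exact (hW t h).le
    · rwa [tanhMomentum_end]

/-! ## Uniqueness of optimal paths between fixed points -/

theorem tendsto_shrink (w : ℝ) :
    Tendsto (fun n : ℕ => (1 - 1 / ((n : ℝ) + 1)) * w) atTop (𝓝 w) := by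
  have := (tendsto_const_nhds (x := (1 : ℝ))).sub tendsto_one_div_add_atTop_nhds_zero_nat
  simpa using this.mul_const w

theorem abs_shrink_lt {w : ℝ} (hw : |w| ≤ 1) (n : ℕ) : |(1 - 1 / ((n : ℝ) + 1)) * w| < 1 := by
  have h1 : 0 < 1 / ((n : ℝ) + 1) := by positivity
  have h2 : 1 / ((n : ℝ) + 1) ≤ 1 := by
    rw [div_le_one (by positivity)]; linarith [n.cast_nonneg (α := ℝ)]
  rw [abs_mul, abs_of_nonneg (by linarith)]
  nlinarith [abs_nonneg w]

theorem DualAdmissible.tendsto_dualValue {b w r x : ℝ} (h : DualAdmissible b w) (r0 : 0 < r)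
    (r1 : r < 1) {u : ℕ → ℝ} (hu : Tendsto u atTop (𝓝 w)) :
    Tendsto (fun n => dualValue r x b (u n)) atTop (𝓝 (dualValue r x b w)) := by
  obtain ⟨p1, p2⟩ := abs_mul_lt_one r0 r1 (abs_le.1 h.abs_le_one)
  have a1 : Tendsto (fun n => (1 + b) * Real.log (1 + u n)) atTop
      (𝓝 ((1 + b) * Real.log (1 + w))) := by
    by_cases hz : 1 + w = 0
    · have : 1 + b = 0 := by rw [h.eq_neg_one (by linarith)]; norm_num
      simp [this]
    · exact ((hu.const_add 1).log hz).const_mul _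
  have a2 : Tendsto (fun n => (1 - b) * Real.log (1 - u n)) atTop
      (𝓝 ((1 - b) * Real.log (1 - w))) := by
    by_cases hz : 1 - w = 0
    · have : 1 - b = 0 := by rw [h.eq_one (by linarith)]; norm_num
      simp [this]
    · exact ((hu.const_sub 1).log hz).const_mul _
  exact (a1.add a2).sub (((((hu.const_mul r).const_add 1).log p1.ne').const_mul _).add
    ((((hu.const_mul r).const_sub 1).log p2.ne').const_mul _))

theorem deriv_integrating_factor {E e c V g : ℝ} (hE : 0 < E) (he : e = E⁻¹)
    (hD : e - c ^ 2 * E ≠ 0)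
    (h : V * (1 - (c * E) ^ 2) = 4 * (c * E) - 2 * g * (1 + (c * E) ^ 2)) :
    (V - 2 * (c * E)) * (e - c ^ 2 * E)⁻¹ +
      (g - c * E) * (-(-2 * e - c ^ 2 * (2 * E)) / (e - c ^ 2 * E) ^ 2) = 0 := by
  have num : (V - 2 * (c * E)) * (e - c ^ 2 * E) + (g - c * E) * (2 * e + 2 * c ^ 2 * E) = 0 := by
    subst he
    field_simp
    linear_combination h
  have : (V - 2 * (c * E)) * (e - c ^ 2 * E)⁻¹ +
      (g - c * E) * (-(-2 * e - c ^ 2 * (2 * E)) / (e - c ^ 2 * E) ^ 2) =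
      ((V - 2 * (c * E)) * (e - c ^ 2 * E) + (g - c * E) * (2 * e + 2 * c ^ 2 * E)) /
        (e - c ^ 2 * E) ^ 2 := by
    field_simp
    ring
  rw [this, num, zero_div]

theorem eq_hamiltonPath_of_lintegral_le {γ : ℝ → ℝ} {T w : ℝ} (hT : 0 < T)
    (hγ : AbsolutelyContinuousOnInterval γ 0 T) (hw : DualAdmissible (γ T) w)
    (h0 : 0 ≤ dualValue (Real.exp (-2 * T)) (γ 0) (γ T) w)
    (hle : ∫⁻ t in Set.Icc 0 T, spinLagrangian (γ t) (deriv γ t) ≤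
      ENNReal.ofReal (dualValue (Real.exp (-2 * T)) (γ 0) (γ T) w)) :
    ∀ t ∈ Set.Icc 0 T, γ t = hamiltonPath (Real.exp (-2 * T) * w) (γ 0) t := by
  set c := Real.exp (-2 * T) * w with hcdef
  have hW : ∀ t < T, |tanhMomentum c t| < 1 := fun t ht =>
    abs_tanhMomentum_lt_of_lt hw.abs_le_one ht
  have hc : |c| < 1 := by simpa [tanhMomentum] using hW 0 hT
  have hfin : ∫⁻ t in Set.Icc 0 T, spinLagrangian (γ t) (deriv γ t) ≠ ∞ :=
    (hle.trans_lt ENNReal.ofReal_lt_top).ne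
  set u : ℕ → ℝ := fun n => (1 - 1 / ((n : ℝ) + 1)) * w with hu
  have hgap := fun n => integral_sub_dualDensity (c := Real.exp (-2 * T) * u n) hT.le hγ hfin
    fun t ht => abs_tanhMomentum_lt (abs_shrink_lt hw.abs_le_one n) ht.2
  simp_rw [← dualValue_eq_dualPrimitive] at hgap
  have hS : (∫⁻ t in Set.Icc 0 T, spinLagrangian (γ t) (deriv γ t)).toReal ≤
      dualValue (Real.exp (-2 * T)) (γ 0) (γ T) w := ENNReal.toReal_le_of_le_ofReal h0 hle
  have hlim : Tendsto (fun n => ∫⁻ t in Set.Icc 0 T,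
      ENNReal.ofReal ((spinLagrangian (γ t) (deriv γ t)).toReal -
        dualDensity (tanhMomentum (Real.exp (-2 * T) * u n) t) (γ t) (deriv γ t))) atTop (𝓝 0) := by
    simp_rw [fun n => (hgap n).1]
    have := ENNReal.tendsto_ofReal ((hw.tendsto_dualValue (x := γ 0) (Real.exp_pos _)
      (exp_neg_two_mul_mem hT).2 (tendsto_shrink w)).const_sub
      (∫⁻ t in Set.Icc 0 T, spinLagrangian (γ t) (deriv γ t)).toReal)
    rwa [ENNReal.ofReal_of_nonpos (p := _ - _) (by linarith)] at this
  have hmeas : AEMeasurable (fun t => liminf (fun n =>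
      ENNReal.ofReal ((spinLagrangian (γ t) (deriv γ t)).toReal -
        dualDensity (tanhMomentum (Real.exp (-2 * T) * u n) t) (γ t) (deriv γ t))) atTop)
      (volume.restrict (Set.Icc 0 T)) := by
    refine ⟨fun t => liminf (fun n => (hgap n).2.1.mk _ t) atTop,
      .liminf fun n => (hgap n).2.1.measurable_mk, ?_⟩
    filter_upwards [ae_all_iff.2 fun n => (hgap n).2.1.ae_eq_mk] with t ht
    simp_rw [ht]
  have hfatou := lintegral_liminf_le' (u := atTop) fun n => (hgap n).2.1
  rw [hlim.liminf_eq, nonpos_iff_eq_zero,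
    lintegral_eq_zero_iff' hmeas] at hfatou
  have hvel : ∀ᵐ t, t ∈ Set.Ico 0 T → DifferentiableAt ℝ γ t ∧ deriv γ t *
      (1 - tanhMomentum c t ^ 2) = 4 * tanhMomentum c t - 2 * γ t * (1 + tanhMomentum c t ^ 2) := by
    filter_upwards [(ae_restrict_iff' measurableSet_Icc).1 hfatou, hγ.ae_differentiableAt,
      (ae_restrict_iff' measurableSet_Icc).1 (ae_lt_top' (aemeasurable_spinLagrangian_path hT.le hγ)
        hfin)] with t h1 h2 h3 ht
    have ht' := Set.Ico_subset_Icc_self ht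
    refine ⟨h2 (by rwa [Set.uIcc_of_le hT.le]), velocity_eq_of_dualDensity_max (hW t ht.2) ?_⟩
    have hWn : Tendsto (fun n => tanhMomentum (Real.exp (-2 * T) * u n) t) atTop
        (𝓝 (tanhMomentum c t)) :=
      ((tendsto_shrink w).const_mul _).mul_const _
    have hcd : ContinuousAt (fun z => dualDensity z (γ t) (deriv γ t)) (tanhMomentum c t) := by
      obtain ⟨q1, q2⟩ := abs_lt.1 (hW t ht.2)
      have hm : ContinuousAt momentum (tanhMomentum c t) :=
        ((continuousAt_const.add continuousAt_id).log (by simp; linarith)).sub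
          ((continuousAt_const.sub continuousAt_id).log (by simp; linarith))
      unfold dualDensity hamiltonian
      exact (hm.mul continuousAt_const).sub
        (((hm.rexp.sub continuousAt_const).mul continuousAt_const).add
          ((hm.neg.rexp.sub continuousAt_const).mul continuousAt_const))
    have hl := ENNReal.tendsto_ofReal ((hcd.tendsto.comp hWn).const_sub
      (spinLagrangian (γ t) (deriv γ t)).toReal)
    have h4 := hl.liminf_eq.symm.trans (h1 ht')
    rw [Pi.zero_apply, ENNReal.ofReal_eq_zero] at h4
    intro q
    have := le_toReal_spinLagrangian (h3 ht') q
    linarith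
  have hIco : Set.EqOn γ (hamiltonPath c (γ 0)) (Set.Ico 0 T) := by
    intro t₁ ht₁
    have hpos : ∀ t < T, 0 < Real.exp (-2 * t) - c ^ 2 * Real.exp (2 * t) := by
      intro t ht
      obtain ⟨e1, e2⟩ := exp_two_mul_pos_inv t
      have h1 := (sq_lt_one_iff_abs_lt_one _).2 (hW t ht)
      have : Real.exp (-2 * t) - c ^ 2 * Real.exp (2 * t) =
          Real.exp (-2 * t) * (1 - tanhMomentum c t ^ 2) := by
        rw [e2, tanhMomentum]; field_simp
      rw [this]
      exact mul_pos (Real.exp_pos _) (by linarith)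
    have hac : AbsolutelyContinuousOnInterval (fun t => (γ t - tanhMomentum c t) *
        (Real.exp (-2 * t) - c ^ 2 * Real.exp (2 * t))⁻¹) 0 t₁ := by
      have hsub : Set.uIcc 0 t₁ ⊆ Set.uIcc 0 T := by
        rw [Set.uIcc_of_le ht₁.1, Set.uIcc_of_le hT.le]
        exact Set.Icc_subset_Icc_right ht₁.2.le
      refine ((hγ.mono hsub).fun_sub (ContDiffOn.absolutelyContinuousOnInterval ?_)).fun_mul
        (ContDiffOn.absolutelyContinuousOnInterval ?_)
      · refine ContDiff.contDiffOn ?_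
        unfold tanhMomentum; fun_prop
      · refine ContDiffOn.inv (ContDiff.contDiffOn (by fun_prop)) fun t ht => ?_
        rw [Set.uIcc_of_le ht₁.1] at ht
        exact (hpos t (ht.2.trans_lt ht₁.2)).ne'
    obtain ⟨k, hk⟩ := hac.const_of_ae_hasDerivAt_zero (by
      filter_upwards [hvel] with t h1 ht
      rw [Set.uIcc_of_le ht₁.1] at ht
      have htT := ht.2.trans_lt ht₁.2
      obtain ⟨h2, h3⟩ := h1 ⟨ht.1, htT⟩
      have hp := (hpos t htT).ne'
      obtain ⟨e1, e2⟩ := exp_two_mul_pos_inv t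
      have d1 : HasDerivAt (fun t : ℝ => Real.exp (-2 * t)) (-2 * Real.exp (-2 * t)) t := by
        have := ((hasDerivAt_id t).const_mul (-2)).exp
        convert! this using 1
        simp; ring
      have d2 : HasDerivAt (fun t : ℝ => Real.exp (2 * t)) (2 * Real.exp (2 * t)) t := by
        have := ((hasDerivAt_id t).const_mul 2).exp
        convert! this using 1
        simp; ring
      have := (h2.hasDerivAt.fun_sub (hasDerivAt_tanhMomentum c t)).fun_mul
        ((d1.fun_sub (d2.const_mul (c ^ 2))).fun_inv hp)
      convert! this using 1
      exact (deriv_integrating_factor e1 e2 hp h3).symm)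
    have k0 := hk 0 (by simp)
    have k1 := hk t₁ (by simp)
    have hp := (hpos t₁ ht₁.2).ne'
    rw [← k0] at k1
    simp only [mul_zero, Real.exp_zero, mul_one, tanhMomentum] at k1
    rw [mul_inv_eq_iff_eq_mul₀ hp] at k1
    simp only [hamiltonPath, tanhMomentum]
    rw [div_eq_mul_inv]
    linarith
  refine hIco.of_subset_closure ?_ (continuous_hamiltonPath _ _).continuousOn
    Set.Ico_subset_Icc_self ?_
  · have := hγ.continuousOn
    rwa [Set.uIcc_of_le hT.le] at this
  · rw [closure_Ico hT.ne]

/-! ## The cost of moving between two points -/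

/-- The optimal dual parameter, a root of
`(b r² - r x) w² + (1 - r²) w - (b - r x) = 0`. -/
noncomputable def dualPoint (r x b : ℝ) : ℝ :=
  2 * (b - r * x) /
    (1 - r ^ 2 + √((1 - r ^ 2) ^ 2 + 4 * (b * r ^ 2 - r * x) * (b - r * x)))

theorem dualPoint_spec {r x b : ℝ} (r0 : 0 < r) (r1 : r < 1) (hx : x ∈ Set.Icc (-1 : ℝ) 1)
    (hb : b ∈ Set.Icc (-1 : ℝ) 1) :
    DualAdmissible b (dualPoint r x b) ∧
      (b * r ^ 2 - r * x) * dualPoint r x b ^ 2 + (1 - r ^ 2) * dualPoint r x b - (b - r * x) = 0 := by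
  have hB : 0 < 1 - r ^ 2 := by nlinarith
  have hdisc : 0 ≤ (1 - r ^ 2) ^ 2 + 4 * (b * r ^ 2 - r * x) * (b - r * x) := by
    have e : (1 - r ^ 2) ^ 2 + 4 * (b * r ^ 2 - r * x) * (b - r * x) =
        (1 - r ^ 2) ^ 2 * (1 - x ^ 2) + (2 * r * b - (1 + r ^ 2) * x) ^ 2 := by ring
    have : 0 ≤ 1 - x ^ 2 := by nlinarith [hx.1, hx.2]
    rw [e]; positivity
  set A := b * r ^ 2 - r * x with hA
  set C := b - r * x with hC
  set B := 1 - r ^ 2 with hBdef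
  set s := √(B ^ 2 + 4 * A * C) with hs
  have hs0 : 0 ≤ s := Real.sqrt_nonneg _
  have hsq : s ^ 2 = B ^ 2 + 4 * A * C := Real.sq_sqrt hdisc
  have hBs : 0 < B + s := by linarith
  have hw : dualPoint r x b = 2 * C / (B + s) := rfl
  set w := dualPoint r x b
  have hwmul : w * (B + s) = 2 * C := by rw [hw]; field_simp
  have hroot : A * w ^ 2 + B * w - C = 0 := by
    rw [hw]
    field_simp
    linear_combination (-C) * hsq
  have q1 : A + B - C = (1 - r ^ 2) * (1 - b) := by rw [hA, hBdef, hC]; ring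
  have q2 : A - B - C = -((1 - r ^ 2) * (1 + b)) := by rw [hA, hBdef, hC]; ring
  have hle : w ≤ 1 := by
    rw [hw, div_le_one hBs]
    by_contra! h
    have h1 : s < 2 * C - B := by linarith
    have h2 : s ^ 2 < (2 * C - B) ^ 2 := by nlinarith
    have h3 : 0 ≤ A + B - C := by rw [q1]; exact mul_nonneg hB.le (by linarith [hb.2])
    have h4 : 0 < C := by linarith
    nlinarith
  have hge : -1 ≤ w := by
    rw [hw, le_div_iff₀ hBs]
    by_contra! h
    have h1 : s < -2 * C - B := by linarith
    have h2 : s ^ 2 < (-2 * C - B) ^ 2 := by nlinarith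
    have h3 : 0 ≤ -A + B + C := by
      have := mul_nonneg hB.le (show 0 ≤ 1 + b by linarith [hb.1]); linarith
    have h4 : C < 0 := by linarith
    nlinarith
  refine ⟨⟨abs_le.2 ⟨hge, hle⟩, fun h => ?_, fun h => ?_⟩, hroot⟩
  · rw [h] at hroot
    have : (1 - r ^ 2) * (1 - b) = 0 := by rw [← q1]; linarith
    rcases mul_eq_zero.1 this with h | h <;> linarith
  · rw [h] at hroot
    have : (1 - r ^ 2) * (1 + b) = 0 := by linarith
    rcases mul_eq_zero.1 this with h | h <;> linarith

theorem continuous_dualPoint {r : ℝ} (r0 : 0 < r) (r1 : r < 1) (b : ℝ) :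
    Continuous fun x => dualPoint r x b := by
  unfold dualPoint
  refine Continuous.div (by fun_prop) (by fun_prop) fun x => ?_
  have h1 : 0 < 1 - r ^ 2 := by nlinarith
  have h2 := Real.sqrt_nonneg ((1 - r ^ 2) ^ 2 + 4 * (b * r ^ 2 - r * x) * (b - r * x))
  linarith

theorem exists_exp_neg_two_mul_eq {r : ℝ} (r0 : 0 < r) (r1 : r < 1) :
    ∃ T, 0 < T ∧ r = Real.exp (-2 * T) := by
  refine ⟨-Real.log r / 2, by linarith [Real.log_neg r0 r1], ?_⟩
  rw [show -2 * (-Real.log r / 2) = Real.log r by ring, Real.exp_log r0]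

theorem abs_mul_lt_one_of_abs_le {r w : ℝ} (r0 : 0 < r) (r1 : r < 1) (hw : |w| ≤ 1) :
    |r * w| < 1 := by
  rw [abs_mul, abs_of_pos r0]; nlinarith [abs_nonneg w]

theorem hamiltonPath_dualPoint {T x b : ℝ} (hT : 0 < T) (hx : x ∈ Set.Icc (-1 : ℝ) 1)
    (hb : b ∈ Set.Icc (-1 : ℝ) 1) :
    hamiltonPath (Real.exp (-2 * T) * dualPoint (Real.exp (-2 * T)) x b) x T = b := by
  obtain ⟨r0, r1⟩ := exp_neg_two_mul_mem hT
  obtain ⟨h1, h2⟩ := dualPoint_spec r0 r1 hx hb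
  have hc := (sq_lt_one_iff_abs_lt_one _).2 (abs_mul_lt_one_of_abs_le r0 r1 h1.abs_le_one)
  simp only [hamiltonPath, tanhMomentum_end]
  have hE : Real.exp (2 * T) = (Real.exp (-2 * T))⁻¹ := by rw [← Real.exp_neg]; ring_nf
  rw [hE]
  generalize Real.exp (-2 * T) = r at *
  generalize dualPoint r x b = w at *
  have hd : 1 - (r * w) ^ 2 ≠ 0 := by linarith
  have : (b - w) * (1 - (r * w) ^ 2) = (x - r * w) * (r - (r * w) ^ 2 * r⁻¹) := by
    field_simp
    linear_combination (-1 : ℝ) * h2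
  rw [div_mul_eq_mul_div, ← this, mul_div_assoc, div_self hd]
  ring

/-- The least cost of a path from `x` to `b` during a time `T` with `r = e⁻²ᵀ`. -/
noncomputable def transitionCost (r x b : ℝ) : ℝ := dualValue r x b (dualPoint r x b)

theorem lintegral_hamiltonPath_dualPoint {T x b : ℝ} (hT : 0 < T) (hx : x ∈ Set.Icc (-1 : ℝ) 1)
    (hb : b ∈ Set.Icc (-1 : ℝ) 1) :
    ∫⁻ t in Set.Icc 0 T, spinLagrangian
        (hamiltonPath (Real.exp (-2 * T) * dualPoint (Real.exp (-2 * T)) x b) x t)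
        (deriv (hamiltonPath (Real.exp (-2 * T) * dualPoint (Real.exp (-2 * T)) x b) x) t) =
      ENNReal.ofReal (transitionCost (Real.exp (-2 * T)) x b) ∧
    0 ≤ transitionCost (Real.exp (-2 * T)) x b := by
  obtain ⟨r0, r1⟩ := exp_neg_two_mul_mem hT
  have h := lintegral_spinLagrangian_hamiltonPath hT
    (dualPoint_spec r0 r1 hx hb).1.abs_le_one hx
  rwa [hamiltonPath_dualPoint hT hx hb] at h

theorem transitionCost_nonneg {r x b : ℝ} (r0 : 0 < r) (r1 : r < 1)
    (hx : x ∈ Set.Icc (-1 : ℝ) 1) (hb : b ∈ Set.Icc (-1 : ℝ) 1) : 0 ≤ transitionCost r x b := by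
  obtain ⟨T, hT, rfl⟩ := exists_exp_neg_two_mul_eq r0 r1
  exact (lintegral_hamiltonPath_dualPoint hT hx hb).2

theorem dualValue_le_transitionCost {r x b w : ℝ} (r0 : 0 < r) (r1 : r < 1)
    (hx : x ∈ Set.Icc (-1 : ℝ) 1) (hb : b ∈ Set.Icc (-1 : ℝ) 1) (hw : DualAdmissible b w) :
    dualValue r x b w ≤ transitionCost r x b := by
  refine le_of_tendsto (hw.tendsto_dualValue r0 r1 (tendsto_shrink w))
    (Eventually.of_forall fun n => ?_)
  obtain ⟨T, hT, rfl⟩ := exists_exp_neg_two_mul_eq r0 r1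
  obtain ⟨h1, h2⟩ := lintegral_hamiltonPath_dualPoint hT hx hb
  have hadm := (dualPoint_spec r0 r1 hx hb).1
  have hend := hamiltonPath_dualPoint hT hx hb
  have h3 := ofReal_dualValue_le_lintegral hT.le
    (isPathTo_hamiltonPath hT hadm.abs_le_one hx hend).1 (abs_shrink_lt hw.abs_le_one n)
  rw [h1, hend, hamiltonPath_zero (abs_mul_lt_one_of_abs_le r0 r1 hadm.abs_le_one)] at h3
  exact (ENNReal.ofReal_le_ofReal_iff h2).1 h3

theorem DualAdmissible.of_abs_lt {w : ℝ} (b : ℝ) (hw : |w| < 1) : DualAdmissible b w := by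
  refine ⟨hw.le, fun h => ?_, fun h => ?_⟩ <;> rw [h] at hw <;> norm_num at hw

theorem transitionCost_le_of_forall {r x b M : ℝ} (r0 : 0 < r) (r1 : r < 1)
    (hx : x ∈ Set.Icc (-1 : ℝ) 1) (hb : b ∈ Set.Icc (-1 : ℝ) 1)
    (h : ∀ w, |w| < 1 → dualValue r x b w ≤ M) : transitionCost r x b ≤ M := by
  have hadm := (dualPoint_spec r0 r1 hx hb).1
  exact le_of_tendsto (hadm.tendsto_dualValue r0 r1 (tendsto_shrink _))
    (Eventually.of_forall fun n => h _ (abs_shrink_lt hadm.abs_le_one n))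

theorem dualValue_sub_dualValue (r x x' b w : ℝ) :
    dualValue r x b w - dualValue r x' b w = -(x - x') * momentum (r * w) := by
  simp only [dualValue, momentum]; ring

theorem momentum_le_momentum {u v : ℝ} (hu : |u| < 1) (hv : |v| < 1) (h : u ≤ v) :
    momentum u ≤ momentum v := by
  obtain ⟨u1, u2⟩ := abs_lt.1 hu
  obtain ⟨v1, v2⟩ := abs_lt.1 hv
  have h1 := Real.log_le_log (by linarith) (show 1 + u ≤ 1 + v by linarith)
  have h2 := Real.log_le_log (by linarith) (show 1 - v ≤ 1 - u by linarith)
  simp only [momentum]; linarith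

theorem momentum_pos {u : ℝ} (hu : |u| < 1) (h : 0 < u) : 0 < momentum u := by
  obtain ⟨u1, u2⟩ := abs_lt.1 hu
  have h1 := Real.log_lt_log (by linarith) (show 1 - u < 1 + u by linarith)
  simp only [momentum]; linarith

theorem momentum_neg (u : ℝ) : momentum (-u) = -momentum u := by
  simp only [momentum, sub_neg_eq_add, ← sub_eq_add_neg]; ring

theorem continuousAt_momentum {u : ℝ} (hu : |u| < 1) : ContinuousAt momentum u := by
  obtain ⟨u1, u2⟩ := abs_lt.1 hu
  exact ((continuousAt_const.add continuousAt_id).log (by simp; linarith)).sub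
    ((continuousAt_const.sub continuousAt_id).log (by simp; linarith))

theorem abs_momentum_mul_le {r w : ℝ} (r0 : 0 < r) (r1 : r < 1) (hw : |w| ≤ 1) :
    |momentum (r * w)| ≤ momentum r := by
  obtain ⟨w1, w2⟩ := abs_le.1 hw
  have hr : |r| < 1 := by rwa [abs_of_pos r0]
  have hrw := abs_mul_lt_one_of_abs_le r0 r1 hw
  rw [abs_le, ← momentum_neg]
  exact ⟨momentum_le_momentum (by rwa [abs_neg]) hrw (by nlinarith),
    momentum_le_momentum hrw hr (by nlinarith)⟩

theorem transitionCost_le_add {r x x' b : ℝ} (r0 : 0 < r) (r1 : r < 1)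
    (hx : x ∈ Set.Icc (-1 : ℝ) 1) (hx' : x' ∈ Set.Icc (-1 : ℝ) 1) (hb : b ∈ Set.Icc (-1 : ℝ) 1) :
    transitionCost r x b ≤
      transitionCost r x' b - (x - x') * momentum (r * dualPoint r x b) := by
  have h1 := dualValue_le_transitionCost r0 r1 hx' hb (dualPoint_spec r0 r1 hx hb).1
  have h2 := dualValue_sub_dualValue r x x' b (dualPoint r x b)
  rw [transitionCost]; linarith

theorem abs_transitionCost_sub_le {r x x' b : ℝ} (r0 : 0 < r) (r1 : r < 1)
    (hx : x ∈ Set.Icc (-1 : ℝ) 1) (hx' : x' ∈ Set.Icc (-1 : ℝ) 1) (hb : b ∈ Set.Icc (-1 : ℝ) 1) :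
    |transitionCost r x b - transitionCost r x' b| ≤ momentum r * |x - x'| := by
  have key : ∀ u ∈ Set.Icc (-1 : ℝ) 1, ∀ v ∈ Set.Icc (-1 : ℝ) 1,
      transitionCost r u b - transitionCost r v b ≤ momentum r * |u - v| := by
    intro u hu v hv
    have h1 := transitionCost_le_add r0 r1 hu hv hb
    have h2 := abs_momentum_mul_le r0 r1 (dualPoint_spec r0 r1 hu hb).1.abs_le_one
    have h3 := neg_abs_le ((u - v) * momentum (r * dualPoint r u b))
    rw [abs_mul] at h3
    nlinarith [abs_nonneg (u - v)]
  rw [abs_le]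
  have h1 := key x hx x' hx'
  have h2 := key x' hx' x hx
  rw [abs_sub_comm] at h2
  constructor <;> linarith

theorem continuousOn_transitionCost {r b : ℝ} (r0 : 0 < r) (r1 : r < 1)
    (hb : b ∈ Set.Icc (-1 : ℝ) 1) :
    ContinuousOn (fun x => transitionCost r x b) (Set.Icc (-1) 1) := by
  have hK : 0 ≤ momentum r := (momentum_pos (by rwa [abs_of_pos r0]) r0).le
  refine (LipschitzOnWith.of_dist_le_mul (K := ⟨momentum r, hK⟩) fun x hx y hy => ?_).continuousOn
  rw [Real.dist_eq, Real.dist_eq]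
  exact abs_transitionCost_sub_le r0 r1 hx hy hb

/-! ## Minimizers of the total cost -/

/-- Initial cost of `x` plus the cost of moving from `x` to `b`. -/
noncomputable def totalCost (a r b x : ℝ) : ℝ := (x ^ 2 - a ^ 2) ^ 2 + transitionCost r x b

/-- `x` is the initial point of an optimal path to `b`. -/
def IsOptimalStart (a r b x : ℝ) : Prop :=
  x ∈ Set.Icc (-1 : ℝ) 1 ∧ ∀ x' ∈ Set.Icc (-1 : ℝ) 1, totalCost a r b x ≤ totalCost a r b x'

theorem continuousOn_totalCost (a : ℝ) {r b : ℝ} (r0 : 0 < r) (r1 : r < 1)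
    (hb : b ∈ Set.Icc (-1 : ℝ) 1) : ContinuousOn (totalCost a r b) (Set.Icc (-1) 1) :=
  ContinuousOn.add (Continuous.continuousOn (by fun_prop)) (continuousOn_transitionCost r0 r1 hb)

theorem exists_isOptimalStart (a : ℝ) {r b : ℝ} (r0 : 0 < r) (r1 : r < 1)
    (hb : b ∈ Set.Icc (-1 : ℝ) 1) : ∃ x, IsOptimalStart a r b x := by
  obtain ⟨x, hx, h⟩ := isCompact_Icc.exists_isMinOn ⟨0, by norm_num⟩
    (continuousOn_totalCost a r0 r1 hb)
  exact ⟨x, hx, fun x' hx' => h hx'⟩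

theorem IsOptimalStart.slope_le {a r b x : ℝ} (r0 : 0 < r) (r1 : r < 1)
    (hb : b ∈ Set.Icc (-1 : ℝ) 1) (h : IsOptimalStart a r b x) :
    (-1 < x → 4 * x * (x ^ 2 - a ^ 2) ≤ momentum (r * dualPoint r x b)) ∧
    (x < 1 → momentum (r * dualPoint r x b) ≤ 4 * x * (x ^ 2 - a ^ 2)) := by
  obtain ⟨hx, hmin⟩ := h
  have key : ∀ x' ∈ Set.Icc (-1 : ℝ) 1, (x - x') * ((x + x') * (x ^ 2 + x' ^ 2 - 2 * a ^ 2)) ≤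
      (x - x') * momentum (r * dualPoint r x' b) := by
    intro x' hx'
    have h1 := transitionCost_le_add r0 r1 hx' hx hb
    have h2 := hmin x' hx'
    simp only [totalCost] at h2
    nlinarith
  have hcont : ContinuousAt (fun x' => momentum (r * dualPoint r x' b) -
      (x + x') * (x ^ 2 + x' ^ 2 - 2 * a ^ 2)) x := by
    refine ContinuousAt.sub ?_ (Continuous.continuousAt (by fun_prop))
    refine ContinuousAt.comp (g := momentum) (continuousAt_momentum
      (abs_mul_lt_one_of_abs_le r0 r1 (dualPoint_spec r0 r1 hx hb).1.abs_le_one)) ?_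
    exact (continuous_const.mul (continuous_dualPoint r0 r1 b)).continuousAt
  have hval : (x + x) * (x ^ 2 + x ^ 2 - 2 * a ^ 2) = 4 * x * (x ^ 2 - a ^ 2) := by ring
  constructor
  · intro hx1
    have := ge_of_tendsto (hcont.tendsto.mono_left (nhdsWithin_le_nhds (s := Set.Iio x))) (b := 0) (by
      filter_upwards [Ioo_mem_nhdsLT hx1] with x' hx'
      have h1 := key x' ⟨hx'.1.le, hx'.2.le.trans hx.2⟩
      have h2 := le_of_mul_le_mul_left h1 (by linarith [hx'.2])
      linarith)
    linarith
  · intro hx1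
    have := le_of_tendsto (hcont.tendsto.mono_left (nhdsWithin_le_nhds (s := Set.Ioi x))) (b := 0) (by
      filter_upwards [Ioo_mem_nhdsGT hx1] with x' hx'
      have h1 := key x' ⟨hx.1.trans hx'.1.le, hx'.2.le⟩
      have h2 : (x' - x) * momentum (r * dualPoint r x' b) ≤
        (x' - x) * ((x + x') * (x ^ 2 + x' ^ 2 - 2 * a ^ 2)) := by linarith
      have h3 := le_of_mul_le_mul_left h2 (by linarith [hx'.1])
      linarith)
    linarith

theorem IsOptimalStart.abs_lt_one_of_zero {a r x : ℝ} (ha₀ : 0 < a) (ha₁ : a < 1) (r0 : 0 < r)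
    (r1 : r < 1) (h : IsOptimalStart a r 0 x) : |x| < 1 := by
  have hb : (0 : ℝ) ∈ Set.Icc (-1 : ℝ) 1 := by norm_num
  obtain ⟨h1, h2⟩ := h.slope_le r0 r1 hb
  have hB : 0 < 1 - r ^ 2 := by nlinarith
  have hD : 0 < 1 - r ^ 2 + √((1 - r ^ 2) ^ 2 + 4 * (0 * r ^ 2 - r * x) * (0 - r * x)) :=
    add_pos_of_pos_of_nonneg hB (Real.sqrt_nonneg _)
  have hadm := abs_mul_lt_one_of_abs_le r0 r1 (dualPoint_spec r0 r1 h.1 hb).1.abs_le_one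
  have ha : a ^ 2 < 1 := by nlinarith
  refine abs_lt.2 ⟨lt_of_le_of_ne h.1.1 ?_, lt_of_le_of_ne h.1.2 ?_⟩
  · intro hx
    have hw : 0 < dualPoint r x 0 := div_pos (by rw [← hx]; linarith) hD
    have := momentum_pos hadm (mul_pos r0 hw)
    have := h2 (by linarith)
    have h3 : 4 * x * (x ^ 2 - a ^ 2) = -(4 * (1 - a ^ 2)) := by rw [← hx]; ring
    linarith
  · intro hx
    have hw : dualPoint r x 0 < 0 := div_neg_of_neg_of_pos (by rw [hx]; linarith) hD
    have := momentum_pos (u := -(r * dualPoint r x 0)) (by rwa [abs_neg]) (by nlinarith)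
    rw [momentum_neg] at this
    have := h1 (by linarith)
    have h3 : 4 * x * (x ^ 2 - a ^ 2) = 4 * (1 - a ^ 2) := by rw [hx]; ring
    linarith

/-! ## Existence and form of the optimal paths -/

theorem initialRate_of_mem {a x : ℝ} (hx : x ∈ Set.Icc (-1 : ℝ) 1) :
    initialRate a x = ENNReal.ofReal ((x ^ 2 - a ^ 2) ^ 2) := by
  simp only [initialRate, if_pos hx]

theorem ofReal_transitionCost_le_lintegral {γ : ℝ → ℝ} {T b : ℝ} (hT : 0 < T)
    (hb : b ∈ Set.Icc (-1 : ℝ) 1) (hγ : IsPathTo T b γ) :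
    ENNReal.ofReal (transitionCost (Real.exp (-2 * T)) (γ 0) b) ≤
      ∫⁻ t in Set.Icc 0 T, spinLagrangian (γ t) (deriv γ t) := by
  obtain ⟨r0, r1⟩ := exp_neg_two_mul_mem hT
  by_cases hfin : ∫⁻ t in Set.Icc 0 T, spinLagrangian (γ t) (deriv γ t) = ∞
  · rw [hfin]; exact le_top
  refine ENNReal.ofReal_le_of_le_toReal (transitionCost_le_of_forall r0 r1
    (hγ.2.1 0 ⟨le_rfl, hT.le⟩) hb fun w hw => ?_)
  have := ofReal_dualValue_le_lintegral hT.le hγ.1 hw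
  rw [hγ.2.2] at this
  exact (ENNReal.ofReal_le_iff_le_toReal hfin).1 this

theorem action_hamiltonPath_dualPoint (a : ℝ) {T x b : ℝ} (hT : 0 < T)
    (hx : x ∈ Set.Icc (-1 : ℝ) 1) (hb : b ∈ Set.Icc (-1 : ℝ) 1) :
    action a T (hamiltonPath (Real.exp (-2 * T) * dualPoint (Real.exp (-2 * T)) x b) x) =
      ENNReal.ofReal (totalCost a (Real.exp (-2 * T)) b x) := by
  obtain ⟨r0, r1⟩ := exp_neg_two_mul_mem hT
  obtain ⟨h1, h2⟩ := lintegral_hamiltonPath_dualPoint hT hx hb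
  rw [action, h1, hamiltonPath_zero (abs_mul_lt_one_of_abs_le r0 r1
    (dualPoint_spec r0 r1 hx hb).1.abs_le_one), initialRate_of_mem hx, totalCost,
    ENNReal.ofReal_add (sq_nonneg _) h2]

theorem ofReal_totalCost_le_action (a : ℝ) {γ : ℝ → ℝ} {T b : ℝ} (hT : 0 < T)
    (hb : b ∈ Set.Icc (-1 : ℝ) 1) (hγ : IsPathTo T b γ) :
    ENNReal.ofReal (totalCost a (Real.exp (-2 * T)) b (γ 0)) ≤ action a T γ := by
  obtain ⟨r0, r1⟩ := exp_neg_two_mul_mem hT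
  have hx := hγ.2.1 0 ⟨le_rfl, hT.le⟩
  rw [action, totalCost, ENNReal.ofReal_add (sq_nonneg _) (transitionCost_nonneg r0 r1 hx hb),
    initialRate_of_mem hx]
  exact add_le_add le_rfl (ofReal_transitionCost_le_lintegral hT hb hγ)

theorem isPathTo_hamiltonPath_dualPoint {T x b : ℝ} (hT : 0 < T) (hx : x ∈ Set.Icc (-1 : ℝ) 1)
    (hb : b ∈ Set.Icc (-1 : ℝ) 1) :
    IsPathTo T b (hamiltonPath (Real.exp (-2 * T) * dualPoint (Real.exp (-2 * T)) x b) x) := by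
  obtain ⟨r0, r1⟩ := exp_neg_two_mul_mem hT
  exact isPathTo_hamiltonPath hT (dualPoint_spec r0 r1 hx hb).1.abs_le_one hx
    (hamiltonPath_dualPoint hT hx hb)

theorem totalCost_nonneg (a : ℝ) {r x b : ℝ} (r0 : 0 < r) (r1 : r < 1)
    (hx : x ∈ Set.Icc (-1 : ℝ) 1) (hb : b ∈ Set.Icc (-1 : ℝ) 1) : 0 ≤ totalCost a r b x :=
  add_nonneg (sq_nonneg _) (transitionCost_nonneg r0 r1 hx hb)

theorem exists_isOptimalPathTo (a : ℝ) {T b : ℝ} (hT : 0 < T) (hb : b ∈ Set.Icc (-1 : ℝ) 1) :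
    ∃ γ, IsOptimalPathTo a T b γ := by
  obtain ⟨r0, r1⟩ := exp_neg_two_mul_mem hT
  obtain ⟨x, hx, hmin⟩ := exists_isOptimalStart a r0 r1 hb
  refine ⟨_, isPathTo_hamiltonPath_dualPoint hT hx hb, fun η hη => ?_⟩
  rw [action_hamiltonPath_dualPoint a hT hx hb]
  exact (ENNReal.ofReal_le_ofReal (hmin _ (hη.2.1 0 ⟨le_rfl, hT.le⟩))).trans
    (ofReal_totalCost_le_action a hT hb hη)

theorem IsOptimalPathTo.isOptimalStart {a T b : ℝ} {γ : ℝ → ℝ} (hT : 0 < T)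
    (hb : b ∈ Set.Icc (-1 : ℝ) 1) (h : IsOptimalPathTo a T b γ) :
    IsOptimalStart a (Real.exp (-2 * T)) b (γ 0) := by
  obtain ⟨r0, r1⟩ := exp_neg_two_mul_mem hT
  refine ⟨h.1.2.1 0 ⟨le_rfl, hT.le⟩, fun x' hx' => ?_⟩
  have h1 := (ofReal_totalCost_le_action a hT hb h.1).trans
    (h.2 _ (isPathTo_hamiltonPath_dualPoint hT hx' hb))
  rw [action_hamiltonPath_dualPoint a hT hx' hb] at h1
  exact (ENNReal.ofReal_le_ofReal_iff (totalCost_nonneg a r0 r1 hx' hb)).1 h1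

theorem IsOptimalPathTo.eq_hamiltonPath {a T b : ℝ} {γ : ℝ → ℝ} (hT : 0 < T)
    (hb : b ∈ Set.Icc (-1 : ℝ) 1) (h : IsOptimalPathTo a T b γ) :
    ∀ t ∈ Set.Icc 0 T, γ t =
      hamiltonPath (Real.exp (-2 * T) * dualPoint (Real.exp (-2 * T)) (γ 0) b) (γ 0) t := by
  obtain ⟨r0, r1⟩ := exp_neg_two_mul_mem hT
  have hx := h.1.2.1 0 ⟨le_rfl, hT.le⟩
  have hend := h.1.2.2
  have h1 := h.2 _ (isPathTo_hamiltonPath_dualPoint hT hx hb)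
  rw [action_hamiltonPath_dualPoint a hT hx hb, totalCost,
    ENNReal.ofReal_add (sq_nonneg _) (transitionCost_nonneg r0 r1 hx hb), action,
    initialRate_of_mem hx] at h1
  have h2 := (ENNReal.add_le_add_iff_left ENNReal.ofReal_ne_top).1 h1
  refine eq_hamiltonPath_of_lintegral_le hT h.1.1 ?_ ?_ ?_
  · rw [hend]; exact (dualPoint_spec r0 r1 hx hb).1
  · rw [hend]; exact transitionCost_nonneg r0 r1 hx hb
  · rw [hend]; exact h2

theorem open_end_condition {c x : ℝ} (hc : |c| < 1) :
    2 * ((c - (x - c) / (1 - c ^ 2) * c ^ 2) - (x - c) / (1 - c ^ 2)) =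
      spinBirth x * Real.exp (momentum c) - spinDeath x * Real.exp (-momentum c) := by
  rw [exp_momentum hc, exp_neg_momentum hc]
  obtain ⟨c1, c2⟩ := abs_lt.1 hc
  have h1 : 1 - c ≠ 0 := by linarith
  have h2 : 1 + c ≠ 0 := by linarith
  have h3 : 1 - c ^ 2 = (1 - c) * (1 + c) := by ring
  simp only [spinBirth, spinDeath, h3]
  field_simp
  ring

theorem IsOptimalPathTo.exists_coeff {a T b : ℝ} {γ : ℝ → ℝ} (ha₀ : 0 < a) (ha₁ : a < 1)
    (hT : 0 < T) (hb : b ∈ Set.Icc (-1 : ℝ) 1) (h : IsOptimalPathTo a T b γ) :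
    ∃ C₁ C₂ : ℝ,
      (∀ t ∈ Set.Icc 0 T, γ t = C₁ * Real.exp (2 * t) + C₂ * Real.exp (-2 * t)) ∧
      C₁ * Real.exp (2 * T) + C₂ * Real.exp (-2 * T) = b ∧
      (b = 0 ∨ |γ 0| < 1 → ∀ p₀ : ℝ, p₀ = 4 * γ 0 * (γ 0 ^ 2 - a ^ 2) →
        2 * (C₁ - C₂) =
          spinBirth (γ 0) * Real.exp p₀ - spinDeath (γ 0) * Real.exp (-p₀)) := by
  obtain ⟨r0, r1⟩ := exp_neg_two_mul_mem hT
  have hx := h.1.2.1 0 ⟨le_rfl, hT.le⟩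
  set c := Real.exp (-2 * T) * dualPoint (Real.exp (-2 * T)) (γ 0) b
  have hc : |c| < 1 := abs_mul_lt_one_of_abs_le r0 r1 (dualPoint_spec r0 r1 hx hb).1.abs_le_one
  have hform : ∀ t ∈ Set.Icc 0 T, γ t = (c - (γ 0 - c) / (1 - c ^ 2) * c ^ 2) * Real.exp (2 * t) +
      (γ 0 - c) / (1 - c ^ 2) * Real.exp (-2 * t) := by
    intro t ht
    rw [h.eq_hamiltonPath hT hb t ht]
    simp only [hamiltonPath, tanhMomentum]
    ring
  refine ⟨_, _, hform, ?_, ?_⟩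
  · rw [← hform T ⟨hT.le, le_rfl⟩, h.1.2.2]
  · rintro h0 p₀ rfl
    have hs := h.isOptimalStart hT hb
    have hlt : |γ 0| < 1 := by
      rcases h0 with rfl | h0
      · exact hs.abs_lt_one_of_zero ha₀ ha₁ r0 r1
      · exact h0
    obtain ⟨x1, x2⟩ := abs_lt.1 hlt
    obtain ⟨h1, h2⟩ := hs.slope_le r0 r1 hb
    rw [le_antisymm (h1 x1) (h2 x2)]
    exact open_end_condition hc

/-! ## Uniqueness of the optimal initial point for small times -/

/-- The initial velocity at the point `x` with the momentum `i'(x)`. -/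
noncomputable def openEndVelocity (a x : ℝ) : ℝ :=
  (1 - x) * Real.exp (4 * x * (x ^ 2 - a ^ 2)) - (1 + x) * Real.exp (-(4 * x * (x ^ 2 - a ^ 2)))

theorem exists_lipschitz_openEndVelocity (a : ℝ) :
    ∃ K : ℝ, 0 ≤ K ∧ ∀ x ∈ Set.Icc (-1 : ℝ) 1, ∀ y ∈ Set.Icc (-1 : ℝ) 1,
      |openEndVelocity a x - openEndVelocity a y| ≤ K * |x - y| := by
  have h : ContDiff ℝ 1 (openEndVelocity a) := by unfold openEndVelocity; fun_prop
  obtain ⟨K, hK⟩ := (h.locallyLipschitz.locallyLipschitzOn).exists_lipschitzOnWith_of_compact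
    (isCompact_Icc (a := (-1 : ℝ)) (b := 1))
  exact ⟨K, K.2, fun x hx y hy => by simpa [Real.dist_eq] using hK.dist_le_mul x hx y hy⟩

theorem hamiltonPath_eq_add {c x T : ℝ} (hc : |c| < 1) :
    hamiltonPath c x T = x * ((Real.exp (2 * T) + Real.exp (-2 * T)) / 2) +
      ((1 - x) * Real.exp (momentum c) - (1 + x) * Real.exp (-momentum c)) *
        ((Real.exp (2 * T) - Real.exp (-2 * T)) / 4) := by
  have h := open_end_condition (x := x) hc
  have h2 : 1 - c ^ 2 ≠ 0 := by
    have := (sq_lt_one_iff_abs_lt_one c).2 hc; linarith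
  have h3 : (x - c) / (1 - c ^ 2) * (1 - c ^ 2) = x - c := by field_simp
  simp only [spinBirth, spinDeath] at h
  rw [← h]
  simp only [hamiltonPath, tanhMomentum]
  linear_combination (Real.exp (2 * T) + Real.exp (-2 * T)) / 2 * h3

theorem openEnd_bounds {a T b x : ℝ} (hT : 0 < T) (hb : b ∈ Set.Icc (-1 : ℝ) 1)
    (h : IsOptimalStart a (Real.exp (-2 * T)) b x) :
    (x < 1 → b ≤ x * ((Real.exp (2 * T) + Real.exp (-2 * T)) / 2) + openEndVelocity a x *
        ((Real.exp (2 * T) - Real.exp (-2 * T)) / 4)) ∧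
    (-1 < x → x * ((Real.exp (2 * T) + Real.exp (-2 * T)) / 2) + openEndVelocity a x *
        ((Real.exp (2 * T) - Real.exp (-2 * T)) / 4) ≤ b) := by
  obtain ⟨r0, r1⟩ := exp_neg_two_mul_mem hT
  obtain ⟨h1, h2⟩ := h.slope_le r0 r1 hb
  have hc := abs_mul_lt_one_of_abs_le r0 r1 (dualPoint_spec r0 r1 h.1 hb).1.abs_le_one
  have hpath := (hamiltonPath_dualPoint hT h.1 hb).symm
  rw [hamiltonPath_eq_add hc] at hpath
  have hS : 0 ≤ (Real.exp (2 * T) - Real.exp (-2 * T)) / 4 := by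
    have := Real.exp_le_exp.2 (show -2 * T ≤ 2 * T by linarith); linarith
  have hmono : ∀ p q : ℝ, p ≤ q → (1 - x) * Real.exp p - (1 + x) * Real.exp (-p) ≤
      (1 - x) * Real.exp q - (1 + x) * Real.exp (-q) := by
    intro p q hpq
    have e1 := mul_le_mul_of_nonneg_left (Real.exp_le_exp.2 hpq)
      (show 0 ≤ 1 - x by linarith [h.1.2])
    have e2 := mul_le_mul_of_nonneg_left (Real.exp_le_exp.2 (neg_le_neg hpq))
      (show 0 ≤ 1 + x by linarith [h.1.1])
    linarith
  constructor
  · intro hx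
    refine hpath.trans_le ((add_le_add_iff_left _).2 ?_)
    exact mul_le_mul_of_nonneg_right (hmono _ _ (h2 hx)) hS
  · intro hx
    refine le_trans ((add_le_add_iff_left _).2 ?_) hpath.symm.le
    exact mul_le_mul_of_nonneg_right (hmono _ _ (h1 hx)) hS

theorem exists_time_unique_start (a : ℝ) :
    ∃ T₀ : ℝ, 0 < T₀ ∧ ∀ T, 0 < T → T ≤ T₀ → ∀ b ∈ Set.Icc (-1 : ℝ) 1, ∀ x y,
      IsOptimalStart a (Real.exp (-2 * T)) b x → IsOptimalStart a (Real.exp (-2 * T)) b y →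
      x = y := by
  obtain ⟨K, hK0, hK⟩ := exists_lipschitz_openEndVelocity a
  have hlim : ContinuousAt (fun T : ℝ => K * ((Real.exp (2 * T) - Real.exp (-2 * T)) / 4)) 0 :=
    Continuous.continuousAt (by fun_prop)
  have hev : ∀ᶠ T in 𝓝 (0 : ℝ), K * ((Real.exp (2 * T) - Real.exp (-2 * T)) / 4) < 1 :=
    hlim.eventually_lt continuousAt_const (by simp)
  obtain ⟨ε, hε, hball⟩ := Metric.eventually_nhds_iff.1 hev
  refine ⟨ε / 2, by linarith, fun T hT hTε b hb => ?_⟩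
  have hKT := hball (y := T) (by rw [Real.dist_eq, sub_zero, abs_of_pos hT]; linarith)
  have key : ∀ x y, x < y → IsOptimalStart a (Real.exp (-2 * T)) b x →
      IsOptimalStart a (Real.exp (-2 * T)) b y → False := by
    intro x y hxy hx hy
    have h1 := (openEnd_bounds hT hb hx).1 (hxy.trans_le hy.1.2)
    have h2 := (openEnd_bounds hT hb hy).2 (hx.1.1.trans_lt hxy)
    have h3 := (abs_le.1 (hK y hy.1 x hx.1)).1
    rw [abs_of_pos (sub_pos.2 hxy)] at h3
    obtain ⟨e1, e2⟩ := exp_two_mul_pos_inv T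
    have hS : 0 ≤ (Real.exp (2 * T) - Real.exp (-2 * T)) / 4 := by
      have := Real.exp_le_exp.2 (show -2 * T ≤ 2 * T by linarith); linarith
    have hC : 1 ≤ (Real.exp (2 * T) + Real.exp (-2 * T)) / 2 := by
      have := Real.add_one_le_exp (2 * T)
      have := Real.add_one_le_exp (-2 * T)
      linarith
    generalize (Real.exp (2 * T) - Real.exp (-2 * T)) / 4 = S at *
    generalize (Real.exp (2 * T) + Real.exp (-2 * T)) / 2 = Ch at *
    have h4 := mul_le_mul_of_nonneg_right h3 hS
    have h5 := mul_lt_mul_of_pos_left hKT (sub_pos.2 hxy)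
    have h6 := mul_le_mul_of_nonneg_left hC (sub_pos.2 hxy).le
    nlinarith
  intro x y hx hy
  rcases lt_trichotomy x y with h | h | h
  · exact (key x y h hx hy).elim
  · exact h
  · exact (key y x h hy hx).elim

/-! ## The optimal initial points for large times -/

theorem dualValue_neg (r x b w : ℝ) : dualValue r (-x) (-b) (-w) = dualValue r x b w := by
  simp only [dualValue, mul_neg, sub_neg_eq_add, ← sub_eq_add_neg]; ring

theorem neg_mem_Icc_one {x : ℝ} (hx : x ∈ Set.Icc (-1 : ℝ) 1) : -x ∈ Set.Icc (-1 : ℝ) 1 :=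
  ⟨by linarith [hx.2], by linarith [hx.1]⟩

theorem transitionCost_neg {r x b : ℝ} (r0 : 0 < r) (r1 : r < 1)
    (hx : x ∈ Set.Icc (-1 : ℝ) 1) (hb : b ∈ Set.Icc (-1 : ℝ) 1) :
    transitionCost r (-x) (-b) = transitionCost r x b := by
  have key : ∀ x ∈ Set.Icc (-1 : ℝ) 1, ∀ b ∈ Set.Icc (-1 : ℝ) 1,
      transitionCost r (-x) (-b) ≤ transitionCost r x b := by
    intro x hx b hb
    refine transitionCost_le_of_forall r0 r1 (neg_mem_Icc_one hx) (neg_mem_Icc_one hb)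
      fun w hw => ?_
    rw [← neg_neg w, dualValue_neg]
    exact dualValue_le_transitionCost r0 r1 hx hb (.of_abs_lt b (by rwa [abs_neg]))
  refine le_antisymm (key x hx b hb) ?_
  simpa using key _ (neg_mem_Icc_one hx) _ (neg_mem_Icc_one hb)

theorem IsOptimalStart.neg {a r x b : ℝ} (r0 : 0 < r) (r1 : r < 1)
    (hb : b ∈ Set.Icc (-1 : ℝ) 1) (h : IsOptimalStart a r b x) : IsOptimalStart a r (-b) (-x) := by
  refine ⟨neg_mem_Icc_one h.1, fun x' hx' => ?_⟩
  have h1 := h.2 (-x') (neg_mem_Icc_one hx')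
  simp only [totalCost] at h1 ⊢
  rw [transitionCost_neg r0 r1 h.1 hb]
  have h2 := transitionCost_neg r0 r1 (neg_mem_Icc_one hx') hb
  rw [neg_neg] at h2
  rw [h2]
  rwa [neg_sq] at h1 ⊢

/-- Starting on the side of the terminal point is strictly cheaper. -/
theorem transitionCost_lt_neg {r u b : ℝ} (r0 : 0 < r) (r1 : r < 1)
    (hu : u ∈ Set.Icc (-1 : ℝ) 1) (hb : b ∈ Set.Icc (-1 : ℝ) 1) (hu0 : 0 < u) (hb0 : 0 < b) :
    transitionCost r u b < transitionCost r (-u) b := by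
  obtain ⟨hadm, hroot⟩ := dualPoint_spec r0 r1 hu hb
  have hu' := neg_mem_Icc_one hu
  rw [transitionCost]
  set w := dualPoint r u b
  have hrw := abs_mul_lt_one_of_abs_le r0 r1 hadm.abs_le_one
  rcases lt_trichotomy w 0 with hw | hw | hw
  · have hw1 : |w| < 1 := by
      refine abs_lt.2 ⟨lt_of_le_of_ne (abs_le.1 hadm.abs_le_one).1 fun h => ?_, by linarith⟩
      have := hadm.eq_neg_one h.symm
      linarith
    have h1 := dualValue_le_transitionCost r0 r1 hu' hb (.of_abs_lt b (w := -w) (by rwa [abs_neg]))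
    have h2 : dualValue r (-u) b (-w) = dualValue r u b w - 2 * b * momentum w := by
      simp only [dualValue, momentum, mul_neg, sub_neg_eq_add, ← sub_eq_add_neg]; ring
    have h3 := momentum_pos (u := -w) (by rwa [abs_neg]) (by linarith)
    rw [momentum_neg] at h3
    nlinarith
  · rw [hw] at hroot
    by_contra! hle
    have h0 : dualValue r u b w = 0 := by rw [hw]; simp [dualValue]
    have hmax : IsLocalMax (dualValue r (-u) b) 0 := by
      filter_upwards [Ioo_mem_nhds (show (-1 : ℝ) < 0 by norm_num) one_pos] with v hv
      have := dualValue_le_transitionCost r0 r1 hu' hb (.of_abs_lt b (abs_lt.2 hv))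
      have h00 : dualValue r (-u) b 0 = 0 := by simp [dualValue]
      linarith
    have d1 : HasDerivAt (fun v : ℝ => Real.log (1 + v)) 1 0 := by
      simpa using ((hasDerivAt_id (0 : ℝ)).const_add 1).log (by simp)
    have d2 : HasDerivAt (fun v : ℝ => Real.log (1 - v)) (-1) 0 := by
      simpa using ((hasDerivAt_id (0 : ℝ)).const_sub 1).log (by simp)
    have d3 : HasDerivAt (fun v : ℝ => Real.log (1 + r * v)) r 0 := by
      simpa using (((hasDerivAt_id (0 : ℝ)).const_mul r).const_add 1).log (by simp)
    have d4 : HasDerivAt (fun v : ℝ => Real.log (1 - r * v)) (-r) 0 := by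
      simpa using (((hasDerivAt_id (0 : ℝ)).const_mul r).const_sub 1).log (by simp)
    have hd := ((d1.const_mul (1 + b)).add (d2.const_mul (1 - b))).sub
      ((d3.const_mul (1 + -u)).add (d4.const_mul (1 - -u)))
    have h4 := hmax.hasDerivAt_eq_zero hd
    nlinarith
  · have h1 := dualValue_le_transitionCost r0 r1 hu' hb hadm
    have h2 := dualValue_sub_dualValue r (-u) u b w
    have h3 := momentum_pos hrw (mul_pos r0 hw)
    nlinarith

theorem transitionCost_midpoint_le {r x y b : ℝ} (r0 : 0 < r) (r1 : r < 1)
    (hx : x ∈ Set.Icc (-1 : ℝ) 1) (hy : y ∈ Set.Icc (-1 : ℝ) 1) (hb : b ∈ Set.Icc (-1 : ℝ) 1) :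
    transitionCost r ((x + y) / 2) b ≤ (transitionCost r x b + transitionCost r y b) / 2 := by
  refine transitionCost_le_of_forall r0 r1 ⟨by linarith [hx.1, hy.1], by linarith [hx.2, hy.2]⟩ hb
    fun w hw => ?_
  have h1 := dualValue_le_transitionCost r0 r1 hx hb (.of_abs_lt b hw)
  have h2 := dualValue_le_transitionCost r0 r1 hy hb (.of_abs_lt b hw)
  have h3 : dualValue r ((x + y) / 2) b w = (dualValue r x b w + dualValue r y b w) / 2 := by
    simp only [dualValue]; ring
  linarith

theorem IsOptimalStart.eq_of_ge {a r b x y : ℝ} (ha₀ : 0 < a) (r0 : 0 < r) (r1 : r < 1)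
    (hb : b ∈ Set.Icc (-1 : ℝ) 1) (hx : IsOptimalStart a r b x) (hy : IsOptimalStart a r b y)
    (hxa : 3 * a / 4 ≤ x) (hya : 3 * a / 4 ≤ y) : x = y := by
  by_contra hne
  have hm : (x + y) / 2 ∈ Set.Icc (-1 : ℝ) 1 :=
    ⟨by linarith [hx.1.1, hy.1.1], by linarith [hx.1.2, hy.1.2]⟩
  have h1 := transitionCost_midpoint_le r0 r1 hx.1 hy.1 hb
  have h2 := hx.2 _ hm
  have h3 := hy.2 _ hm
  simp only [totalCost] at h2 h3
  have hd : 0 < (x - y) ^ 2 := by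
    have := sub_ne_zero.2 hne; positivity
  have hma : (3 * a / 4) ^ 2 ≤ ((x + y) / 2) ^ 2 := by
    have : 3 * a / 4 ≤ (x + y) / 2 := by linarith
    exact pow_le_pow_left₀ (by linarith) this 2
  have hid : (x ^ 2 - a ^ 2) ^ 2 + (y ^ 2 - a ^ 2) ^ 2 - 2 * (((x + y) / 2) ^ 2 - a ^ 2) ^ 2 =
      (x - y) ^ 2 / 2 * (6 * ((x + y) / 2) ^ 2 + (x - y) ^ 2 / 4 - 2 * a ^ 2) := by ring
  have hpos : 0 < (x - y) ^ 2 / 2 * (6 * ((x + y) / 2) ^ 2 + (x - y) ^ 2 / 4 - 2 * a ^ 2) :=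
    mul_pos (by linarith) (by nlinarith)
  linarith

theorem exists_time_start_near_wells {a : ℝ} (ha₀ : 0 < a) (ha₁ : a < 1) :
    ∃ T₁ : ℝ, 0 < T₁ ∧ ∀ T, T₁ ≤ T → ∀ b ∈ Set.Icc (-1 : ℝ) 1, ∀ x,
      IsOptimalStart a (Real.exp (-2 * T)) b x → 3 * a / 4 ≤ |x| := by
  have hlim : Tendsto (fun T : ℝ => 2 * momentum (Real.exp (-2 * T))) atTop (𝓝 0) := by
    have h1 : Tendsto (fun T : ℝ => Real.exp (-2 * T)) atTop (𝓝 0) :=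
      Real.tendsto_exp_atBot.comp (tendsto_id.const_mul_atTop_of_neg (by norm_num))
    have h2 := ((continuousAt_momentum (u := 0) (by simp)).tendsto.comp h1).const_mul 2
    simpa [momentum] using h2
  obtain ⟨T₁, hT₁⟩ := eventually_atTop.1 (hlim.eventually_lt_const
    (show 0 < (7 * a ^ 2 / 16) ^ 2 by positivity))
  refine ⟨max T₁ 1, by positivity, fun T hT b hb x hx => ?_⟩
  have hTpos : 0 < T := lt_of_lt_of_le (by positivity) hT
  obtain ⟨r0, r1⟩ := exp_neg_two_mul_mem hTpos
  have h1 := hT₁ T ((le_max_left _ _).trans hT)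
  generalize Real.exp (-2 * T) = r at *
  have ha : a ∈ Set.Icc (-1 : ℝ) 1 := ⟨by linarith, ha₁.le⟩
  have h2 := hx.2 a ha
  have h3 := (abs_le.1 (abs_transitionCost_sub_le r0 r1 ha hx.1 hb)).2
  have h4 : |a - x| ≤ 2 := abs_le.2 ⟨by linarith [hx.1.2], by linarith [hx.1.1]⟩
  have h5 : 0 < momentum r := momentum_pos (by rwa [abs_of_pos r0]) r0
  simp only [totalCost] at h2
  by_contra! hlt
  have h6 : x ^ 2 < (3 * a / 4) ^ 2 := by
    rw [← sq_abs]; exact pow_lt_pow_left₀ hlt (abs_nonneg x) two_ne_zero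
  have h7 : (7 * a ^ 2 / 16) ^ 2 ≤ (x ^ 2 - a ^ 2) ^ 2 := by
    have h8 : 7 * a ^ 2 / 16 ≤ a ^ 2 - x ^ 2 := by linarith
    have h9 := pow_le_pow_left₀ (by positivity) h8 2
    linarith [show (a ^ 2 - x ^ 2) ^ 2 = (x ^ 2 - a ^ 2) ^ 2 by ring]
  have h8 := mul_le_mul_of_nonneg_left h4 h5.le
  simp only [sub_self, ne_eq, OfNat.ofNat_ne_zero, not_false_eq_true, zero_pow] at h2
  linarith

theorem IsOptimalStart.ge_of_pos {a r b x : ℝ} (r0 : 0 < r) (r1 : r < 1)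
    (hb : b ∈ Set.Icc (-1 : ℝ) 1) (hb0 : 0 < b) (hx : IsOptimalStart a r b x)
    (hxa : 3 * a / 4 ≤ |x|) : 3 * a / 4 ≤ x := by
  rcases le_or_gt 0 x with h | h
  · rwa [abs_of_nonneg h] at hxa
  · have hx' := neg_mem_Icc_one hx.1
    have h1 := hx.2 _ hx'
    have h2 := transitionCost_lt_neg r0 r1 hx' hb (neg_pos.2 h) hb0
    rw [neg_neg] at h2
    simp only [totalCost, neg_sq] at h1
    linarith

/-! ## Consequences of the large deviation principle -/

theorem HasLDP.eventually_le {μ : ℕ → Measure ℝ} {I : ℝ → ℝ≥0∞} (h : HasLDP μ I) {C : Set ℝ}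
    (hC : IsClosed C) {s s' : ℝ} (hs : ∀ x ∈ C, ENNReal.ofReal s ≤ I x) (hs' : s' < s) :
    ∀ᶠ N : ℕ in atTop, μ N C ≤ ENNReal.ofReal (Real.exp (-(N * s'))) := by
  have h1 : ((s' : ℝ) : EReal) < ((⨅ x ∈ C, I x : ℝ≥0∞) : EReal) := by
    have h2 : ((ENNReal.ofReal s : ℝ≥0∞) : EReal) ≤ ((⨅ x ∈ C, I x : ℝ≥0∞) : EReal) :=
      EReal.coe_ennreal_le_coe_ennreal_iff.2 (le_iInf₂ hs)
    refine lt_of_lt_of_le ?_ h2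
    rw [EReal.coe_ennreal_ofReal, EReal.coe_lt_coe_iff]
    exact hs'.trans_le (le_max_left _ _)
  have h3 := eventually_lt_of_limsup_lt ((h.1 C hC).trans_lt (EReal.neg_lt_neg_iff.2 h1))
  filter_upwards [h3, eventually_gt_atTop 0] with N hN hN0
  rw [EReal.div_lt_iff (by exact_mod_cast hN0) (EReal.natCast_ne_top N)] at hN
  rw [← ENNReal.log_le_log_iff, ENNReal.log_ofReal_of_pos (Real.exp_pos _), Real.log_exp]
  refine hN.le.trans_eq ?_
  rw [← EReal.coe_neg, ← EReal.coe_natCast, ← EReal.coe_mul]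
  congr 1; ring

theorem HasLDP.eventually_ge {μ : ℕ → Measure ℝ} {I : ℝ → ℝ≥0∞} (h : HasLDP μ I) {G : Set ℝ}
    (hG : IsOpen G) {x s s' : ℝ} (hx : x ∈ G) (hs : I x ≤ ENNReal.ofReal s) (hs0 : 0 ≤ s)
    (hs' : s < s') :
    ∀ᶠ N : ℕ in atTop, ENNReal.ofReal (Real.exp (-(N * s'))) ≤ μ N G := by
  have h1 : ((⨅ x ∈ G, I x : ℝ≥0∞) : EReal) < ((s' : ℝ) : EReal) := by
    have h2 : ((⨅ x ∈ G, I x : ℝ≥0∞) : EReal) ≤ ((ENNReal.ofReal s : ℝ≥0∞) : EReal) :=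
      EReal.coe_ennreal_le_coe_ennreal_iff.2 ((iInf₂_le x hx).trans hs)
    refine lt_of_le_of_lt h2 ?_
    rw [EReal.coe_ennreal_ofReal, EReal.coe_lt_coe_iff, max_eq_left hs0]
    exact hs'
  have h3 := eventually_lt_of_lt_liminf ((EReal.neg_lt_neg_iff.2 h1).trans_le (h.2 G hG))
  filter_upwards [h3, eventually_gt_atTop 0] with N hN hN0
  rw [EReal.lt_div_iff (by exact_mod_cast hN0) (EReal.natCast_ne_top N)] at hN
  rw [← ENNReal.log_le_log_iff, ENNReal.log_ofReal_of_pos (Real.exp_pos _), Real.log_exp]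
  refine le_trans (le_of_eq ?_) hN.le
  rw [← EReal.coe_neg, ← EReal.coe_natCast, ← EReal.coe_mul]
  congr 1; ring

/-! ## The joint law of the endpoints -/

theorem site_injective {N : ℕ} (hN : N ≠ 0) : Function.Injective (site N) := by
  intro i j h
  have hN' : (N : ℝ) ≠ 0 := by exact_mod_cast hN
  simp only [site] at h
  rw [div_left_inj' hN', sub_left_inj, Nat.cast_inj] at h
  exact Fin.ext h

theorem site_mem {N : ℕ} (hN : N ≠ 0) (i : Fin (2 * N + 1)) :
    site N i ∈ Set.Icc (-1 : ℝ) 1 := by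
  have hN' : (0 : ℝ) < N := by exact_mod_cast Nat.pos_of_ne_zero hN
  have hi : ((i : ℕ) : ℝ) ≤ 2 * N := by exact_mod_cast Nat.lt_succ_iff.1 i.2
  have hi0 : (0 : ℝ) ≤ (i : ℕ) := Nat.cast_nonneg _
  simp only [site]
  constructor
  · rw [le_div_iff₀ hN']; linarith
  · rw [div_le_iff₀ hN']; linarith

/-- The probability that `X_0 ∈ A` and `X_T` is the `j`-th site. -/
noncomputable def jointMass (N : ℕ) (T : ℝ) (μ : Measure ℝ) (j : Fin (2 * N + 1)) (A : Set ℝ) :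
    ℝ≥0∞ :=
  ∑ i, A.indicator (fun x => μ {x}) (site N i) * ENNReal.ofReal (spinTransition N T i j)

theorem endpointLaw_apply {N : ℕ} (hN : N ≠ 0) (T : ℝ) (μ : Measure ℝ) (j : Fin (2 * N + 1))
    {A : Set ℝ} (hA : MeasurableSet A) :
    endpointLaw N T μ ({z | z.2 = site N j} ∩ Prod.fst ⁻¹' A) = jointMass N T μ j A := by
  have hm : MeasurableSet ({z : ℝ × ℝ | z.2 = site N j} ∩ Prod.fst ⁻¹' A) :=
    (measurableSet_eq_fun measurable_snd measurable_const).inter (measurable_fst hA)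
  simp only [endpointLaw, jointMass, Measure.finsetSum_apply, Measure.smul_apply, smul_eq_mul,
    Measure.dirac_apply' _ hm]
  refine Finset.sum_congr rfl fun i _ => ?_
  rw [Finset.sum_eq_single j]
  · by_cases h : site N i ∈ A <;> simp [Set.indicator, h]
  · intro k _ hk
    have : site N k ≠ site N j := fun h => hk (site_injective hN h)
    simp [Set.indicator, this]
  · simp

theorem initialLawGiven_apply {N : ℕ} (hN : N ≠ 0) (T : ℝ) (μ : Measure ℝ) (j : Fin (2 * N + 1))
    {A : Set ℝ} (hA : MeasurableSet A) :
    initialLawGiven N T μ (site N j) A =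
      (jointMass N T μ j Set.univ)⁻¹ * jointMass N T μ j A := by
  have hm : MeasurableSet {z : ℝ × ℝ | z.2 = site N j} :=
    measurableSet_eq_fun measurable_snd measurable_const
  rw [initialLawGiven, Measure.map_apply measurable_fst hA, cond_apply hm,
    endpointLaw_apply hN T μ j hA, ← endpointLaw_apply hN T μ j MeasurableSet.univ,
    Set.preimage_univ, Set.inter_univ]

theorem sum_indicator_sites {N : ℕ} (hN : N ≠ 0) (μ : Measure ℝ) (A : Set ℝ) :
    ∑ i, A.indicator (fun x => μ {x}) (site N i) = μ (A ∩ Set.range (site N)) := by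
  classical
  have h := measure_biUnion_finset (μ := μ)
    (s := Finset.univ.filter fun i : Fin (2 * N + 1) => site N i ∈ A)
    (f := fun i => {site N i})
    (fun i _ j _ hij => Set.disjoint_singleton.2 fun h => hij (site_injective hN h))
    (fun i _ => measurableSet_singleton _)
  rw [Finset.sum_filter] at h
  convert! h.symm using 1
  congr 1
  ext x
  simp only [Set.mem_inter_iff, Set.mem_range, Finset.mem_filter, Finset.mem_univ, true_and,
    Set.mem_iUnion, Set.mem_singleton_iff, exists_prop]
  constructor
  · rintro ⟨h1, i, rfl⟩; exact ⟨i, h1, rfl⟩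
  · rintro ⟨i, h1, rfl⟩; exact ⟨h1, i, rfl⟩

theorem jointMass_le {N : ℕ} (hN : N ≠ 0) (T : ℝ) (μ : Measure ℝ) (j : Fin (2 * N + 1))
    {A : Set ℝ} {K : ℝ} (hK : ∀ i, site N i ∈ A → spinTransition N T i j ≤ K) :
    jointMass N T μ j A ≤ μ A * ENNReal.ofReal K := by
  refine le_trans (Finset.sum_le_sum (g := fun i =>
    A.indicator (fun x => μ {x}) (site N i) * ENNReal.ofReal K) fun i _ => ?_) ?_
  · by_cases h : site N i ∈ A
    · exact mul_le_mul_right (ENNReal.ofReal_le_ofReal (hK i h)) _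
    · simp [h]
  · rw [← Finset.sum_mul, sum_indicator_sites hN]
    exact mul_le_mul_left (measure_mono Set.inter_subset_left) _

theorem le_jointMass_univ {N : ℕ} (hN : N ≠ 0) (T : ℝ) {μ : Measure ℝ} [IsProbabilityMeasure μ]
    (hμ : μ (Set.range (site N)) = 1) (j : Fin (2 * N + 1))
    {A : Set ℝ} {K : ℝ} (hK : ∀ i, site N i ∈ A → K ≤ spinTransition N T i j) :
    μ A * ENNReal.ofReal K ≤ jointMass N T μ j Set.univ := by
  have hr : MeasurableSet (Set.range (site N)) := (Set.finite_range _).measurableSet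
  have h0 : ∀ᵐ x ∂μ, x ∈ Set.range (site N) := (prob_compl_eq_zero_iff hr).2 hμ
  have hA : μ A = μ (A ∩ Set.range (site N)) :=
    measure_congr (by
      filter_upwards [h0] with x hx using propext ⟨fun h => ⟨h, hx⟩, fun h => h.1⟩)
  rw [hA, ← sum_indicator_sites hN, Finset.sum_mul]
  refine Finset.sum_le_sum fun i _ => ?_
  by_cases h : site N i ∈ A
  · simpa [h] using mul_le_mul_right (ENNReal.ofReal_le_ofReal (hK i h)) _
  · simp [h]

theorem jointMass_ne_top {N : ℕ} (T : ℝ) (μ : Measure ℝ) [IsProbabilityMeasure μ]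
    (j : Fin (2 * N + 1)) (A : Set ℝ) : jointMass N T μ j A ≠ ∞ := by
  refine ENNReal.sum_ne_top.2 fun i _ => ENNReal.mul_ne_top ?_ ENNReal.ofReal_ne_top
  by_cases h : site N i ∈ A <;> simp [h, measure_ne_top]

/-! ## Continuity of the cost -/

theorem transitionCost_le_of_near {r x b : ℝ} (r0 : 0 < r) (r1 : r < 1)
    (hx : x ∈ Set.Icc (-1 : ℝ) 1) (hb : b ∈ Set.Icc (-1 : ℝ) 1) :
    ∃ k : ℝ, 0 ≤ k ∧ ∀ x' ∈ Set.Icc (-1 : ℝ) 1, ∀ y ∈ Set.Icc (-1 : ℝ) 1,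
      transitionCost r x' y ≤ transitionCost r x b + k * (|x' - x| + |y - b|) := by
  have conv : ∀ e ∈ Set.Icc (-1 : ℝ) 1, ∀ y ∈ Set.Icc (-1 : ℝ) 1, ∀ θ : ℝ, 0 ≤ θ → θ ≤ 1 →
      y = (1 - θ) * b + θ * e →
      transitionCost r x y ≤ transitionCost r x b + θ * transitionCost r x e := by
    intro e he y hy θ h0 h1 hyθ
    refine transitionCost_le_of_forall r0 r1 hx hy fun w hw => ?_
    have e1 := dualValue_le_transitionCost r0 r1 hx hb (.of_abs_lt b hw)
    have e2 := dualValue_le_transitionCost r0 r1 hx he (.of_abs_lt e hw)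
    have e3 : dualValue r x y w = (1 - θ) * dualValue r x b w + θ * dualValue r x e w := by
      rw [hyθ]; simp only [dualValue]; ring
    have e4 := mul_le_mul_of_nonneg_left e1 (sub_nonneg.2 h1)
    have e5 := mul_le_mul_of_nonneg_left e2 h0
    have e6 := mul_nonneg h0 (transitionCost_nonneg r0 r1 hx hb)
    linarith
  have m1 : (1 : ℝ) ∈ Set.Icc (-1 : ℝ) 1 := by norm_num
  have m2 : (-1 : ℝ) ∈ Set.Icc (-1 : ℝ) 1 := by norm_num
  have n1 := transitionCost_nonneg r0 r1 hx m1
  have n2 := transitionCost_nonneg r0 r1 hx m2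
  have hK : 0 ≤ momentum r := (momentum_pos (by rwa [abs_of_pos r0]) r0).le
  have k1 : 0 ≤ transitionCost r x 1 / (1 - b) := div_nonneg n1 (by linarith [hb.2])
  have k2 : 0 ≤ transitionCost r x (-1) / (1 + b) := div_nonneg n2 (by linarith [hb.1])
  have main : ∀ y ∈ Set.Icc (-1 : ℝ) 1, transitionCost r x y ≤ transitionCost r x b +
      (transitionCost r x 1 / (1 - b) + transitionCost r x (-1) / (1 + b)) * |y - b| := by
    intro y hy
    rcases lt_trichotomy y b with h | h | h
    · have hb' : 0 < 1 + b := by linarith [hy.1]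
      have := conv (-1) m2 y hy ((b - y) / (1 + b)) (div_nonneg (by linarith) hb'.le)
        ((div_le_one hb').2 (by linarith [hy.1])) (by field_simp; ring)
      rw [abs_of_neg (by linarith)]
      have e : (b - y) / (1 + b) * transitionCost r x (-1) =
        transitionCost r x (-1) / (1 + b) * -(y - b) := by ring
      nlinarith [mul_nonneg k1 (show 0 ≤ -(y - b) by linarith)]
    · rw [h]; simp
    · have hb' : 0 < 1 - b := by linarith [hy.2]
      have := conv 1 m1 y hy ((y - b) / (1 - b)) (div_nonneg (by linarith) hb'.le)
        ((div_le_one hb').2 (by linarith [hy.2])) (by field_simp; ring)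
      rw [abs_of_pos (by linarith)]
      have e : (y - b) / (1 - b) * transitionCost r x 1 =
        transitionCost r x 1 / (1 - b) * (y - b) := by ring
      nlinarith [mul_nonneg k2 (show 0 ≤ y - b by linarith)]
  refine ⟨transitionCost r x 1 / (1 - b) + transitionCost r x (-1) / (1 + b) + momentum r,
    by linarith, fun x' hx' y hy => ?_⟩
  have h1 := main y hy
  have h2 := (abs_le.1 (abs_transitionCost_sub_le r0 r1 hx' hx hy)).2
  nlinarith [abs_nonneg (x' - x), abs_nonneg (y - b),
    mul_nonneg (add_nonneg k1 k2) (abs_nonneg (x' - x)), mul_nonneg hK (abs_nonneg (y - b))]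

theorem exists_dualValue_gt {r x b ε : ℝ} (r0 : 0 < r) (r1 : r < 1)
    (hx : x ∈ Set.Icc (-1 : ℝ) 1) (hb : b ∈ Set.Icc (-1 : ℝ) 1) (hε : 0 < ε) :
    ∃ w, |w| < 1 ∧ transitionCost r x b - ε < dualValue r x b w := by
  by_contra! h
  have := transitionCost_le_of_forall r0 r1 hx hb h
  linarith

/-! ## Concentration of the conditional laws -/

theorem eventually_jointMass_univ_ge {a T b x : ℝ} {μ : ℕ → Measure ℝ}
    (hμ : IsInitialSequence a μ) (hT : 0 < T) (hb : b ∈ Set.Icc (-1 : ℝ) 1)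
    (hx : x ∈ Set.Icc (-1 : ℝ) 1) {y : ℕ → ℝ} (hy : ApproachesThroughSites y b) {ε : ℝ}
    (hε : 0 < ε) :
    ∀ᶠ N : ℕ in atTop, ∀ j, site N j = y N →
      ENNReal.ofReal (Real.exp (-(N * (totalCost a (Real.exp (-2 * T)) b x + ε))) / (2 * N + 1)) ≤
        jointMass N T (μ N) j Set.univ := by
  obtain ⟨r0, r1⟩ := exp_neg_two_mul_mem hT
  obtain ⟨k, hk0, hk⟩ := transitionCost_le_of_near r0 r1 hx hb
  have hδ : 0 < ε / (4 * (k + 1)) := by positivity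
  have hG := hμ.ldp.eventually_ge (Metric.isOpen_ball (x := x) (ε := ε / (4 * (k + 1))))
    (Metric.mem_ball_self hδ) (initialRate_of_mem (a := a) hx).le (sq_nonneg _)
    (show (x ^ 2 - a ^ 2) ^ 2 < (x ^ 2 - a ^ 2) ^ 2 + ε / 2 by linarith)
  have hyb := Metric.tendsto_nhds.1 hy.2 _ hδ
  filter_upwards [hG, hyb, eventually_gt_atTop 0] with N hN hyN hN0 j hj
  have hN0' : N ≠ 0 := hN0.ne'
  have := hμ.isProbabilityMeasure N
  have hlow : ∀ i, site N i ∈ Metric.ball x (ε / (4 * (k + 1))) →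
      Real.exp (-(N * (transitionCost (Real.exp (-2 * T)) x b + ε / 2))) / (2 * N + 1) ≤
        spinTransition N T i j := by
    intro i hi
    obtain ⟨w, hw, hle⟩ := exists_le_spinTransition hN0' hT i j
    rw [div_le_iff₀ (by positivity), mul_comm (spinTransition N T i j)]
    refine le_trans (Real.exp_le_exp.2 (neg_le_neg ?_)) hle
    refine mul_le_mul_of_nonneg_left ?_ (Nat.cast_nonneg N)
    have h1 := dualValue_le_transitionCost r0 r1 (site_mem hN0' i) (site_mem hN0' j)
      (.of_abs_lt _ (abs_lt.2 hw))
    have h2 := hk _ (site_mem hN0' i) _ (site_mem hN0' j)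
    rw [Metric.mem_ball, Real.dist_eq] at hi
    rw [Real.dist_eq, ← hj] at hyN
    have h3 : k * (|site N i - x| + |site N j - b|) ≤ ε / 2 := by
      have h4 : |site N i - x| + |site N j - b| ≤ ε / (2 * (k + 1)) := by
        have : ε / (2 * (k + 1)) = ε / (4 * (k + 1)) + ε / (4 * (k + 1)) := by field_simp; ring
        linarith
      calc k * (|site N i - x| + |site N j - b|) ≤ (k + 1) * (ε / (2 * (k + 1))) := by
            gcongr; linarith
        _ = ε / 2 := by field_simp
    linarith
  refine le_trans ?_ (le_jointMass_univ hN0' T (hμ.carried_by_sites N) j hlow)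
  refine le_trans (le_of_eq ?_) (mul_le_mul_left hN _)
  rw [← ENNReal.ofReal_mul (Real.exp_pos _).le, mul_div_assoc', ← Real.exp_add]
  congr 3
  simp only [totalCost]; ring

theorem exists_nhds_eventually_jointMass_le {a T b x ε : ℝ} {μ : ℕ → Measure ℝ}
    (hμ : IsInitialSequence a μ) (hT : 0 < T) (hb : b ∈ Set.Icc (-1 : ℝ) 1)
    (hx : x ∈ Set.Icc (-1 : ℝ) 1) {y : ℕ → ℝ} (hy : ApproachesThroughSites y b) (hε : 0 < ε) :
    ∃ C ∈ 𝓝 x, IsClosed C ∧ ∀ᶠ N : ℕ in atTop, ∀ j, site N j = y N →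
      jointMass N T (μ N) j C ≤
        ENNReal.ofReal (Real.exp (-(N * (totalCost a (Real.exp (-2 * T)) b x - ε)))) := by
  obtain ⟨r0, r1⟩ := exp_neg_two_mul_mem hT
  obtain ⟨w, hw, hD⟩ := exists_dualValue_gt r0 r1 hx hb (show 0 < ε / 4 by linarith)
  have hc1 : ContinuousAt (fun z : ℝ × ℝ => dualValue (Real.exp (-2 * T)) z.1 z.2 w) (x, b) := by
    unfold dualValue; fun_prop
  have hev := hc1.eventually_const_lt (show transitionCost (Real.exp (-2 * T)) x b - ε / 4 <
    dualValue (Real.exp (-2 * T)) (x, b).1 (x, b).2 w from hD)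
  obtain ⟨δ₁, hδ₁, hball⟩ := Metric.eventually_nhds_iff.1 hev
  have hc2 : ContinuousAt (fun z : ℝ => (z ^ 2 - a ^ 2) ^ 2) x := by fun_prop
  obtain ⟨δ₂, hδ₂, hball₂⟩ := Metric.eventually_nhds_iff.1 (hc2.eventually_const_lt
    (show (x ^ 2 - a ^ 2) ^ 2 - ε / 4 < (x ^ 2 - a ^ 2) ^ 2 by linarith))
  set δ := min δ₁ δ₂ / 2 with hδdef
  have hδ : 0 < δ := by positivity
  have hδ1 : δ < δ₁ := by have := min_le_left δ₁ δ₂; have := lt_min hδ₁ hδ₂; linarith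
  have hδ2 : δ < δ₂ := by have := min_le_right δ₁ δ₂; have := lt_min hδ₁ hδ₂; linarith
  refine ⟨Metric.closedBall x δ, Metric.closedBall_mem_nhds x hδ, Metric.isClosed_closedBall, ?_⟩
  have hldp := hμ.ldp.eventually_le (Metric.isClosed_closedBall (x := x) (ε := δ))
    (s := (x ^ 2 - a ^ 2) ^ 2 - ε / 4) (s' := (x ^ 2 - a ^ 2) ^ 2 - ε / 2) (fun z hz => by
      by_cases hz1 : z ∈ Set.Icc (-1 : ℝ) 1
      · rw [initialRate_of_mem hz1]
        exact ENNReal.ofReal_le_ofReal (hball₂ ((Metric.mem_closedBall.1 hz).trans_lt hδ2)).le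
      · simp only [initialRate, if_neg hz1]; exact le_top) (by linarith)
  have hyb := Metric.tendsto_nhds.1 hy.2 _ hδ₁
  filter_upwards [hldp, hyb, eventually_gt_atTop 0] with N hN hyN hN0 j hj
  have hN0' : N ≠ 0 := hN0.ne'
  have hup : ∀ i, site N i ∈ Metric.closedBall x δ → spinTransition N T i j ≤
      Real.exp (-(N * (transitionCost (Real.exp (-2 * T)) x b - ε / 4))) := by
    intro i hi
    refine (spinTransition_le hN0' hT (abs_lt.1 hw) i j).trans
      (Real.exp_le_exp.2 (neg_le_neg (mul_le_mul_of_nonneg_left ?_ (Nat.cast_nonneg N))))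
    refine (hball (y := (site N i, site N j)) ?_).le
    rw [Prod.dist_eq, hj]
    exact max_lt ((Metric.mem_closedBall.1 hi).trans_lt hδ1) hyN
  refine (jointMass_le hN0' T (μ N) j hup).trans ((mul_le_mul_left hN _).trans ?_)
  rw [← ENNReal.ofReal_mul (Real.exp_pos _).le, ← Real.exp_add]
  refine ENNReal.ofReal_le_ofReal (Real.exp_le_exp.2 ?_)
  have : (0 : ℝ) ≤ N * (ε / 4) := by positivity
  simp only [totalCost]
  nlinarith

theorem tendsto_mul_exp_neg {ε : ℝ} (hε : 0 < ε) :
    Tendsto (fun N : ℕ => (2 * (N : ℝ) + 1) * Real.exp (-(N * ε))) atTop (𝓝 0) := by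
  have h1 : Tendsto (fun t : ℝ => (2 * t + 1) * Real.exp (-(t * ε))) atTop (𝓝 0) := by
    have h2 := (Real.tendsto_pow_mul_exp_neg_atTop_nhds_zero 1).comp
      (tendsto_id.atTop_mul_const hε)
    have h3 := (Real.tendsto_exp_neg_atTop_nhds_zero).comp (tendsto_id.atTop_mul_const hε)
    have h4 := (h2.const_mul (2 / ε)).add h3
    simp only [mul_zero, add_zero] at h4
    refine h4.congr fun t => ?_
    simp only [Function.comp_apply, id, pow_one]
    field_simp
  exact h1.comp tendsto_natCast_atTop_atTop

/-- The conditional laws put asymptotically no mass on closed sets without optimal initial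
points. -/
theorem tendsto_initialLawGiven_zero {a T b : ℝ} {μ : ℕ → Measure ℝ}
    (hμ : IsInitialSequence a μ) (hT : 0 < T) (hb : b ∈ Set.Icc (-1 : ℝ) 1) {y : ℕ → ℝ}
    (hy : ApproachesThroughSites y b) {C : Set ℝ} (hC : IsClosed C)
    (hmin : ∀ x ∈ C, ¬ IsOptimalStart a (Real.exp (-2 * T)) b x) :
    Tendsto (fun N => initialLawGiven N T (μ N) (y N) C) atTop (𝓝 0) := by
  obtain ⟨r0, r1⟩ := exp_neg_two_mul_mem hT
  obtain ⟨x₀, hx₀⟩ := exists_isOptimalStart a r0 r1 hb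
  have hcpt : IsCompact (C ∩ Set.Icc (-1) 1) := isCompact_Icc.inter_left hC
  have hlim : Tendsto (fun N => initialLawGiven N T (μ N) (y N) (C ∩ Set.Icc (-1) 1)) atTop
      (𝓝 0) := by
    refine hcpt.induction_on
      (p := fun S => Tendsto (fun N => initialLawGiven N T (μ N) (y N) S) atTop (𝓝 0))
      (by simp) (fun s t hst ht => ?_) (fun s t hs ht => ?_) (fun x hx => ?_)
    · exact tendsto_of_tendsto_of_tendsto_of_le_of_le tendsto_const_nhds ht
        (fun _ => zero_le) fun _ => measure_mono hst
    · refine tendsto_of_tendsto_of_tendsto_of_le_of_le tendsto_const_nhds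
        (by simpa using hs.add ht) (fun _ => zero_le) fun _ => measure_union_le _ _
    · have hlt : totalCost a (Real.exp (-2 * T)) b x₀ < totalCost a (Real.exp (-2 * T)) b x := by
        by_contra! hle
        exact hmin x hx.1 ⟨hx.2, fun x' hx' => hle.trans (hx₀.2 x' hx')⟩
      set ε := (totalCost a (Real.exp (-2 * T)) b x - totalCost a (Real.exp (-2 * T)) b x₀) / 3
        with hεdef
      have hε : 0 < ε := by rw [hεdef]; linarith
      obtain ⟨S, hS, hScl, hup⟩ := exists_nhds_eventually_jointMass_le hμ hT hb hx.2 hy hε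
      refine ⟨S, mem_nhdsWithin_of_mem_nhds hS, ?_⟩
      have hden := eventually_jointMass_univ_ge hμ hT hb hx₀.1 hy hε
      have hz : Tendsto (fun N : ℕ => ENNReal.ofReal ((2 * (N : ℝ) + 1) * Real.exp (-(N * ε))))
          atTop (𝓝 0) := by
        simpa using ENNReal.tendsto_ofReal (tendsto_mul_exp_neg hε)
      refine tendsto_of_tendsto_of_tendsto_of_le_of_le' tendsto_const_nhds hz
        (Eventually.of_forall fun _ => zero_le) ?_
      filter_upwards [hup, hden, eventually_gt_atTop 0] with N h1 h2 hN0
      obtain ⟨j, hj⟩ := hy.1 N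
      rw [← hj, initialLawGiven_apply hN0.ne' T (μ N) j hScl.measurableSet]
      refine (mul_le_mul' (ENNReal.inv_le_inv.2 (h2 j hj)) (h1 j hj)).trans (le_of_eq ?_)
      rw [← ENNReal.ofReal_inv_of_pos (by positivity), ← ENNReal.ofReal_mul (by positivity)]
      congr 1
      rw [inv_div, div_mul_eq_mul_div, mul_div_assoc, ← Real.exp_sub]
      congr 2
      rw [hεdef]; ring
  refine hlim.congr' ?_
  filter_upwards [eventually_gt_atTop 0] with N hN0
  obtain ⟨j, hj⟩ := hy.1 N
  rw [← hj, initialLawGiven_apply hN0.ne' T (μ N) j hC.measurableSet,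
    initialLawGiven_apply hN0.ne' T (μ N) j (hC.inter isClosed_Icc).measurableSet]
  congr 1
  refine Finset.sum_congr rfl fun i _ => ?_
  have := site_mem hN0.ne' i
  by_cases h : site N i ∈ C <;> simp only [Set.indicator, Set.mem_inter_iff, h, this, and_true,
    if_true, if_false]

theorem eventually_isProbabilityMeasure_initialLawGiven {a T b : ℝ} {μ : ℕ → Measure ℝ}
    (hμ : IsInitialSequence a μ) (hT : 0 < T) (hb : b ∈ Set.Icc (-1 : ℝ) 1) {y : ℕ → ℝ}
    (hy : ApproachesThroughSites y b) :
    ∀ᶠ N in atTop, IsProbabilityMeasure (initialLawGiven N T (μ N) (y N)) := by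
  have hden := eventually_jointMass_univ_ge hμ hT hb hb hy one_pos
  filter_upwards [hden, eventually_gt_atTop 0] with N h2 hN0
  obtain ⟨j, hj⟩ := hy.1 N
  have := hμ.isProbabilityMeasure N
  have hne : jointMass N T (μ N) j Set.univ ≠ 0 := by
    refine (lt_of_lt_of_le ?_ (h2 j hj)).ne'
    rw [ENNReal.ofReal_pos]; positivity
  refine ⟨?_⟩
  rw [← hj, initialLawGiven_apply hN0.ne' T (μ N) j MeasurableSet.univ]
  exact ENNReal.inv_mul_cancel hne (jointMass_ne_top T (μ N) j _)

/-! ## Weak convergence to a point mass -/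

theorem weaklyTendsto_dirac {ν : ℕ → Measure ℝ} {x : ℝ}
    (hp : ∀ᶠ N in atTop, IsProbabilityMeasure (ν N))
    (h : ∀ δ : ℝ, 0 < δ → Tendsto (fun N => ν N {z | δ ≤ |z - x|}) atTop (𝓝 0)) :
    WeaklyTendsto ν (Measure.dirac x) := by
  intro f
  rw [integral_dirac, Metric.tendsto_nhds]
  intro ε hε
  obtain ⟨δ, hδ, hf⟩ := Metric.continuous_iff.1 f.continuous x (ε / 2) (half_pos hε)
  set S : Set ℝ := {z | δ ≤ |z - x|} with hS
  have hSm : MeasurableSet S :=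
    (isClosed_le continuous_const (continuous_id.sub continuous_const).abs).measurableSet
  have h1 : Tendsto (fun N => 2 * ‖f‖ * (ν N).real S) atTop (𝓝 0) := by
    have := ((ENNReal.tendsto_toReal ENNReal.zero_ne_top).comp (h δ hδ)).const_mul (2 * ‖f‖)
    simpa [Measure.real, Function.comp_def] using this
  filter_upwards [hp, h1.eventually (gt_mem_nhds (half_pos hε))] with N hN hlt
  have hi : Integrable (fun z => f z - f x) (ν N) := (f.integrable _).sub (integrable_const _)
  have e1 : ∫ z, f z ∂ν N - f x = ∫ z, (f z - f x) ∂ν N := by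
    rw [integral_sub (f.integrable _) (integrable_const _)]; simp
  have hind : Integrable (S.indicator fun _ => 2 * ‖f‖) (ν N) :=
    (integrable_const _).indicator hSm
  have e2 : ‖∫ z, (f z - f x) ∂ν N‖ ≤ ∫ z, (ε / 2 + S.indicator (fun _ => 2 * ‖f‖) z) ∂ν N := by
    refine (norm_integral_le_integral_norm _).trans
      (integral_mono hi.norm ((integrable_const _).add hind) fun z => ?_)
    by_cases hz : z ∈ S
    · have := f.norm_coe_le_norm z
      have := f.norm_coe_le_norm x
      simp only [hz, Set.indicator_of_mem]
      linarith [norm_sub_le (f z) (f x)]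
    · simp only [hz, not_false_eq_true, Set.indicator_of_notMem, add_zero]
      exact (hf z (by simpa [hS, Real.dist_eq] using hz)).le
  have e3 : ∫ z, (ε / 2 + S.indicator (fun _ => 2 * ‖f‖) z) ∂ν N =
      ε / 2 + 2 * ‖f‖ * (ν N).real S := by
    rw [integral_add (integrable_const _) hind, integral_indicator_const _ hSm]
    simp [mul_comm]
  rw [Real.dist_eq, e1]
  rw [e3, Real.norm_eq_abs] at e2
  linarith

theorem WeaklyTendsto.notMem_of_measure_le {ν : ℕ → Measure ℝ} {x : ℝ} {U : Set ℝ}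
    (h : WeaklyTendsto ν (Measure.dirac x)) (hU : IsOpen U)
    (hν : ∀ᶠ N in atTop, IsProbabilityMeasure (ν N) ∧ ν N U ≤ 1 / 2) : x ∉ U := by
  intro hx
  obtain ⟨f, hf0, hf1, hf⟩ := exists_bounded_zero_one_of_closed hU.isClosed_compl
    (isClosed_singleton (x := x)) (Set.disjoint_singleton_right.2 fun h => h hx)
  have h1 := h f
  rw [integral_dirac, hf1 rfl] at h1
  have h2 : ∀ᶠ N in atTop, ∫ z, f z ∂ν N ≤ 1 / 2 := by
    filter_upwards [hν] with N hN
    have := hN.1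
    have hle : ∫ z, f z ∂ν N ≤ ∫ z, U.indicator (fun _ => (1 : ℝ)) z ∂ν N := by
      refine integral_mono (f.integrable _) ((integrable_const _).indicator hU.measurableSet)
        fun z => ?_
      by_cases hz : z ∈ U
      · simpa [hz] using (hf z).2
      · simpa [hz] using (hf0 hz).le
    rw [integral_indicator_const _ hU.measurableSet, smul_eq_mul, mul_one] at hle
    refine hle.trans ?_
    have := ENNReal.toReal_mono (by simp) hN.2
    simpa [Measure.real] using this
  have := le_of_tendsto h1 h2
  norm_num at this

theorem abs_real_sub_le_variationalDist {ν ν' : Measure ℝ} [IsProbabilityMeasure ν]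
    [IsProbabilityMeasure ν'] {A : Set ℝ} (hA : MeasurableSet A) :
    |ν.real A - ν'.real A| ≤ variationalDist ν ν' := by
  refine le_ciSup (f := fun A : {A : Set ℝ // MeasurableSet A} => |ν.real A - ν'.real A|)
    ⟨1, ?_⟩ ⟨A, hA⟩
  rintro _ ⟨B, rfl⟩
  have h1 : ν.real B ≤ 1 := measureReal_le_one
  have h2 : ν'.real B ≤ 1 := measureReal_le_one
  have h3 : 0 ≤ ν.real B := measureReal_nonneg
  have h4 : 0 ≤ ν'.real B := measureReal_nonneg
  exact abs_le.2 ⟨by linarith, by linarith⟩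

/-! ## Terminal points -/

theorem exists_approachesThroughSites {b : ℝ} (hb : b ∈ Set.Icc (-1 : ℝ) 1) :
    ∃ y, ApproachesThroughSites y b := by
  have h0 : 0 ≤ 1 + b := by linarith [hb.1]
  have hlt : ∀ N : ℕ, ⌊(1 + b) * (N : ℝ)⌋₊ < 2 * N + 1 := fun N => by
    rw [Nat.lt_succ_iff]
    refine Nat.floor_le_of_le ?_
    push_cast
    exact mul_le_mul_of_nonneg_right (by linarith [hb.2]) (Nat.cast_nonneg N)
  refine ⟨fun N => site N ⟨_, hlt N⟩, fun N => ⟨_, rfl⟩, ?_⟩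
  have h1 := ((tendsto_nat_floor_mul_div_atTop h0).comp
    (tendsto_natCast_atTop_atTop (R := ℝ))).sub_const 1
  rw [add_sub_cancel_left] at h1
  refine h1.congr' ?_
  filter_upwards [eventually_gt_atTop 0] with N hN
  have hN' : (N : ℝ) ≠ 0 := by exact_mod_cast hN.ne'
  simp only [site, Function.comp]
  field_simp

theorem exists_approachesThroughSites_of_eventually {P : ℕ → ℝ → Prop} {b : ℝ}
    (h : ∀ ε : ℝ, 0 < ε → ∀ᶠ N in atTop, ∃ i, |site N i - b| < ε ∧ P N (site N i)) :
    ∃ y, ApproachesThroughSites y b ∧ ∀ᶠ N in atTop, P N (y N) := by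
  classical
  have hex : ∀ N : ℕ, ∃ k : Fin (2 * N + 1), ∀ i, P N (site N i) →
      P N (site N k) ∧ |site N k - b| ≤ |site N i - b| := by
    intro N
    by_cases hP : ∃ i, P N (site N i)
    · obtain ⟨i, hi⟩ := hP
      obtain ⟨k, hk, hmin⟩ := Finset.exists_min_image
        (Finset.univ.filter fun i : Fin (2 * N + 1) => P N (site N i))
        (fun i => |site N i - b|) ⟨i, by simpa using hi⟩
      exact ⟨k, fun i hi => ⟨by simpa using hk, hmin i (by simpa using hi)⟩⟩
    · exact ⟨0, fun i hi => absurd ⟨i, hi⟩ hP⟩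
  choose k hk using hex
  refine ⟨fun N => site N (k N), ⟨fun N => ⟨_, rfl⟩, ?_⟩, ?_⟩
  · rw [Metric.tendsto_nhds]
    intro ε hε
    filter_upwards [h ε hε] with N ⟨i, hi, hPi⟩
    rw [Real.dist_eq]
    exact ((hk N i hPi).2).trans_lt hi
  · filter_upwards [h 1 one_pos] with N ⟨i, _, hPi⟩ using (hk N i hPi).1

/-! ## Reflection symmetry -/

theorem site_rev (N : ℕ) (i : Fin (2 * N + 1)) : site N (Fin.rev i) = -site N i := by
  have h : ((Fin.rev i : Fin (2 * N + 1)) : ℕ) + i = 2 * N := by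
    have := i.2
    rw [Fin.val_rev]; omega
  have h' : (((Fin.rev i : Fin (2 * N + 1)) : ℕ) : ℝ) = 2 * N - i := by
    rw [eq_sub_iff_add_eq]; exact_mod_cast h
  simp only [site, h']
  ring

theorem spinQ_rev (N : ℕ) (i j : Fin (2 * N + 1)) :
    spinQ N (Fin.rev i) (Fin.rev j) = spinQ N i j := by
  have h : ∀ s z : ℝ, Set.indicator {-s} (fun _ => (1 : ℝ)) (-z) =
      Set.indicator {s} (fun _ => (1 : ℝ)) z := fun s z => by
    simp [Set.indicator]
  simp only [spinQ, walkGenerator, spinBirth, spinDeath, site_rev, h]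
  rw [show -site N i + 1 / (N : ℝ) = -(site N i - 1 / N) by ring,
    show -site N i - 1 / (N : ℝ) = -(site N i + 1 / N) by ring, h, h]
  ring

theorem spinTransition_rev (N : ℕ) (t : ℝ) (i j : Fin (2 * N + 1)) :
    spinTransition N t (Fin.rev i) (Fin.rev j) = spinTransition N t i j := by
  open scoped Matrix.Norms.Operator in
  have h := NormedSpace.map_exp (Matrix.reindexAlgEquiv ℝ ℝ (Fin.revPerm (n := 2 * N + 1)))
    ((Matrix.reindexAlgEquiv ℝ ℝ
      (Fin.revPerm (n := 2 * N + 1))).toLinearMap.continuous_of_finiteDimensional) (t • spinQ N)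
  have hQ : Matrix.reindexAlgEquiv ℝ ℝ (Fin.revPerm (n := 2 * N + 1)) (t • spinQ N) =
      t • spinQ N := by
    ext i j
    simp [Matrix.coe_reindexAlgEquiv, spinQ_rev]
  rw [hQ] at h
  have := congrFun (congrFun h i) j
  simp only [Matrix.coe_reindexAlgEquiv, Matrix.reindex_apply, Matrix.submatrix_apply,
    Fin.revPerm_symm, Fin.revPerm_apply] at this
  exact this

theorem jointMass_neg {N : ℕ} (T : ℝ) {μ : Measure ℝ} (hμ : μ.map (fun x => -x) = μ)
    {j : Fin (2 * N + 1)} (hj : Fin.rev j = j) (A : Set ℝ) :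
    jointMass N T μ j ((fun x => -x) ⁻¹' A) = jointMass N T μ j A := by
  have hs : ∀ x : ℝ, μ {-x} = μ {x} := fun x => by
    nth_rw 2 [← hμ]
    rw [Measure.map_apply measurable_neg (measurableSet_singleton x)]
    congr 1
    ext z
    simp
  rw [jointMass, jointMass, ← Equiv.sum_comp Fin.revPerm]
  refine Finset.sum_congr rfl fun i _ => ?_
  rw [Fin.revPerm_apply, ← spinTransition_rev N T i j, hj, site_rev]
  congr 1
  by_cases h : site N i ∈ A <;> simp [Set.indicator, h, hs]

/-! ## Bad points and optimal starting points -/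

theorem conditionedConvergesToPointMass_of_unique {a T b : ℝ} {μ : ℕ → Measure ℝ}
    (hμ : IsInitialSequence a μ) (hT : 0 < T) (hb : b ∈ Set.Icc (-1 : ℝ) 1)
    (h : ∀ x y, IsOptimalStart a (Real.exp (-2 * T)) b x →
      IsOptimalStart a (Real.exp (-2 * T)) b y → x = y) :
    ConditionedConvergesToPointMass μ T b := by
  obtain ⟨r0, r1⟩ := exp_neg_two_mul_mem hT
  obtain ⟨x, hx⟩ := exists_isOptimalStart a r0 r1 hb
  refine ⟨x, fun y hy => weaklyTendsto_dirac
    (eventually_isProbabilityMeasure_initialLawGiven hμ hT hb hy) fun δ hδ =>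
    tendsto_initialLawGiven_zero hμ hT hb hy
      (isClosed_le continuous_const (continuous_id.sub continuous_const).abs) fun z hz hopt => ?_⟩
  have hz' : δ ≤ |z - x| := hz
  rw [h z x hopt hx, sub_self, abs_zero] at hz'
  exact hz'.not_gt hδ

theorem badPoints_eq_empty_of_unique {a T : ℝ} {μ : ℕ → Measure ℝ}
    (hμ : IsInitialSequence a μ) (hT : 0 < T)
    (h : ∀ b ∈ Set.Icc (-1 : ℝ) 1, ∀ x y, IsOptimalStart a (Real.exp (-2 * T)) b x →
      IsOptimalStart a (Real.exp (-2 * T)) b y → x = y) :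
    badPoints μ T = ∅ :=
  Set.eq_empty_of_forall_notMem fun b hb =>
    hb.2.1 (conditionedConvergesToPointMass_of_unique hμ hT hb.1 (h b hb.1))

theorem IsOptimalStart.unique_of_ne_zero {a r b : ℝ} (ha₀ : 0 < a) (r0 : 0 < r) (r1 : r < 1)
    (hwell : ∀ b ∈ Set.Icc (-1 : ℝ) 1, ∀ x, IsOptimalStart a r b x → 3 * a / 4 ≤ |x|)
    (hb : b ∈ Set.Icc (-1 : ℝ) 1) (hb0 : b ≠ 0) {x y : ℝ} (hx : IsOptimalStart a r b x)
    (hy : IsOptimalStart a r b y) : x = y := by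
  have pos : ∀ {b x y : ℝ}, b ∈ Set.Icc (-1 : ℝ) 1 → 0 < b → IsOptimalStart a r b x →
      IsOptimalStart a r b y → x = y := fun hb hb0 hx hy =>
    hx.eq_of_ge ha₀ r0 r1 hb hy (hx.ge_of_pos r0 r1 hb hb0 (hwell _ hb _ hx))
      (hy.ge_of_pos r0 r1 hb hb0 (hwell _ hb _ hy))
  rcases hb0.lt_or_gt with h | h
  · exact neg_injective (pos (neg_mem_Icc_one hb) (neg_pos.2 h) (hx.neg r0 r1 hb)
      (hy.neg r0 r1 hb))
  · exact pos hb h hx hy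

section LongTime

variable {a T : ℝ} {μ : ℕ → Measure ℝ}

theorem tendsto_initialLawGiven_Iic (ha₀ : 0 < a) (hμ : IsInitialSequence a μ) (hT : 0 < T)
    (hwell : ∀ b ∈ Set.Icc (-1 : ℝ) 1, ∀ x,
      IsOptimalStart a (Real.exp (-2 * T)) b x → 3 * a / 4 ≤ |x|)
    {b : ℝ} (hb : b ∈ Set.Icc (-1 : ℝ) 1) (hb0 : 0 < b) {y : ℕ → ℝ}
    (hy : ApproachesThroughSites y b) :
    Tendsto (fun N => initialLawGiven N T (μ N) (y N) (Set.Iic (a / 2))) atTop (𝓝 0) := by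
  obtain ⟨r0, r1⟩ := exp_neg_two_mul_mem hT
  refine tendsto_initialLawGiven_zero hμ hT hb hy isClosed_Iic fun x hx hopt => ?_
  have := hopt.ge_of_pos r0 r1 hb hb0 (hwell b hb x hopt)
  linarith [Set.mem_Iic.1 hx]

theorem tendsto_initialLawGiven_Ici (ha₀ : 0 < a) (hμ : IsInitialSequence a μ) (hT : 0 < T)
    (hwell : ∀ b ∈ Set.Icc (-1 : ℝ) 1, ∀ x,
      IsOptimalStart a (Real.exp (-2 * T)) b x → 3 * a / 4 ≤ |x|)
    {b : ℝ} (hb : b ∈ Set.Icc (-1 : ℝ) 1) (hb0 : b < 0) {y : ℕ → ℝ}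
    (hy : ApproachesThroughSites y b) :
    Tendsto (fun N => initialLawGiven N T (μ N) (y N) (Set.Ici (-(a / 2)))) atTop (𝓝 0) := by
  obtain ⟨r0, r1⟩ := exp_neg_two_mul_mem hT
  refine tendsto_initialLawGiven_zero hμ hT hb hy isClosed_Ici fun x hx hopt => ?_
  have hneg := hopt.neg r0 r1 hb
  have := hneg.ge_of_pos r0 r1 (neg_mem_Icc_one hb) (neg_pos.2 hb0)
    (hwell _ (neg_mem_Icc_one hb) _ hneg)
  linarith [Set.mem_Ici.1 hx]

theorem conditionedLawsSeparate_zero (ha₀ : 0 < a) (hμ : IsInitialSequence a μ) (hT : 0 < T)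
    (hwell : ∀ b ∈ Set.Icc (-1 : ℝ) 1, ∀ x,
      IsOptimalStart a (Real.exp (-2 * T)) b x → 3 * a / 4 ≤ |x|) :
    ConditionedLawsSeparate μ T 0 := by
  have hpos : ∀ k : ℕ, (0 : ℝ) < 1 / ((k : ℝ) + 1) := fun k => by positivity
  have hmem : ∀ k : ℕ, 1 / ((k : ℝ) + 1) ∈ Set.Icc (-1 : ℝ) 1 := fun k =>
    ⟨by linarith [hpos k], (div_le_one (by positivity)).2 (by linarith [k.cast_nonneg (α := ℝ)])⟩
  refine ⟨fun k => 1 / ((k : ℝ) + 1), fun k => -(1 / ((k : ℝ) + 1)), hmem,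
    fun k => neg_mem_Icc_one (hmem k), tendsto_one_div_add_atTop_nhds_zero_nat,
    by simpa using (tendsto_one_div_add_atTop_nhds_zero_nat (𝕜 := ℝ)).neg, 1 / 2, by norm_num,
    Eventually.of_forall fun k y z hy hz => ?_⟩
  have hy0 := (ENNReal.tendsto_toReal ENNReal.zero_ne_top).comp
    (tendsto_initialLawGiven_Iic ha₀ hμ hT hwell (hmem k) (hpos k) hy)
  have hz0 := (ENNReal.tendsto_toReal ENNReal.zero_ne_top).comp
    (tendsto_initialLawGiven_Ici ha₀ hμ hT hwell (neg_mem_Icc_one (hmem k))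
      (neg_lt_zero.2 (hpos k)) hz)
  rw [ENNReal.toReal_zero] at hy0 hz0
  filter_upwards [hy0.eventually (gt_mem_nhds (show (0 : ℝ) < 1 / 4 by norm_num)),
    hz0.eventually (gt_mem_nhds (show (0 : ℝ) < 1 / 4 by norm_num)),
    eventually_isProbabilityMeasure_initialLawGiven hμ hT (hmem k) hy,
    eventually_isProbabilityMeasure_initialLawGiven hμ hT (neg_mem_Icc_one (hmem k)) hz]
    with N h1 h2 i1 i2
  refine le_trans ?_ (abs_real_sub_le_variationalDist (measurableSet_Iic (a := a / 2)))
  have h3 : (initialLawGiven N T (μ N) (z N)).real (Set.Iic (a / 2))ᶜ ≤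
      (initialLawGiven N T (μ N) (z N)).real (Set.Ici (-(a / 2))) := by
    refine measureReal_mono fun x hx => ?_
    have : a / 2 < x := by simpa using hx
    exact Set.mem_Ici.2 (by linarith)
  rw [probReal_compl_eq_one_sub measurableSet_Iic] at h3
  simp only [Function.comp, ← measureReal_def] at h1 h2
  rw [abs_sub_comm]
  exact le_trans (by linarith) (le_abs_self _)

theorem not_conditionedConvergesToPointMass_zero (ha₀ : 0 < a) (hμ : IsInitialSequence a μ)
    (hT : 0 < T)
    (hwell : ∀ b ∈ Set.Icc (-1 : ℝ) 1, ∀ x,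
      IsOptimalStart a (Real.exp (-2 * T)) b x → 3 * a / 4 ≤ |x|) :
    ¬ ConditionedConvergesToPointMass μ T 0 := by
  rintro ⟨x, hx⟩
  have key : ∀ U : Set ℝ, IsOpen U →
      (∀ ε : ℝ, 0 < ε → ∃ b ∈ Set.Icc (-1 : ℝ) 1, |b| < ε ∧ ∀ y, ApproachesThroughSites y b →
        Tendsto (fun N => initialLawGiven N T (μ N) (y N) U) atTop (𝓝 0)) → x ∉ U := by
    intro U hU h
    obtain ⟨y, hy, hP⟩ := exists_approachesThroughSites_of_eventually (b := 0)
      (P := fun N y => IsProbabilityMeasure (initialLawGiven N T (μ N) y) ∧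
        initialLawGiven N T (μ N) y U ≤ 1 / 2) fun ε hε => by
      obtain ⟨b, hb, hbε, hlim⟩ := h ε hε
      obtain ⟨y, hy⟩ := exists_approachesThroughSites hb
      filter_upwards [eventually_isProbabilityMeasure_initialLawGiven hμ hT hb hy,
        (hlim y hy).eventually (gt_mem_nhds (show (0 : ℝ≥0∞) < 1 / 2 by simp)),
        hy.2.abs.eventually (gt_mem_nhds hbε)] with N h1 h2 h3
      obtain ⟨i, hi⟩ := hy.1 N
      exact ⟨i, by rwa [sub_zero, hi], by rw [hi]; exact ⟨h1, h2.le⟩⟩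
    exact (hx y hy).notMem_of_measure_le hU hP
  have small : ∀ ε : ℝ, 0 < ε → ∃ b ∈ Set.Icc (-1 : ℝ) 1, 0 < b ∧ b < ε := fun ε hε =>
    ⟨min (ε / 2) 1, ⟨by linarith [lt_min (half_pos hε) one_pos], min_le_right _ _⟩,
      lt_min (half_pos hε) one_pos, (min_le_left _ _).trans_lt (half_lt_self hε)⟩
  have h1 : x ∉ Set.Iio (a / 2) := key _ isOpen_Iio fun ε hε => by
    obtain ⟨b, hb, hb0, hbε⟩ := small ε hε
    exact ⟨b, hb, by rwa [abs_of_pos hb0], fun y hy =>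
      tendsto_of_tendsto_of_tendsto_of_le_of_le tendsto_const_nhds
        (tendsto_initialLawGiven_Iic ha₀ hμ hT hwell hb hb0 hy) (fun _ => zero_le)
        fun _ => measure_mono Set.Iio_subset_Iic_self⟩
  have h2 : x ∉ Set.Ioi (-(a / 2)) := key _ isOpen_Ioi fun ε hε => by
    obtain ⟨b, hb, hb0, hbε⟩ := small ε hε
    exact ⟨-b, neg_mem_Icc_one hb, by rwa [abs_neg, abs_of_pos hb0], fun y hy =>
      tendsto_of_tendsto_of_tendsto_of_le_of_le tendsto_const_nhds
        (tendsto_initialLawGiven_Ici ha₀ hμ hT hwell (neg_mem_Icc_one hb) (neg_lt_zero.2 hb0) hy)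
        (fun _ => zero_le) fun _ => measure_mono Set.Ioi_subset_Ici_self⟩
  rw [Set.mem_Iio, not_lt] at h1
  rw [Set.mem_Ioi, not_lt] at h2
  linarith

theorem not_weaklyTendsto_zero_of_symmetric (ha₀ : 0 < a) (hμ : IsInitialSequence a μ)
    (hT : 0 < T)
    (hwell : ∀ b ∈ Set.Icc (-1 : ℝ) 1, ∀ x,
      IsOptimalStart a (Real.exp (-2 * T)) b x → 3 * a / 4 ≤ |x|)
    (hsymm : ∀ N, (μ N).map (fun x => -x) = μ N) :
    ¬ ∃ x : ℝ, WeaklyTendsto (fun N => initialLawGiven N T (μ N) 0) (Measure.dirac x) := by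
  rintro ⟨x, hx⟩
  have h0 : (0 : ℝ) ∈ Set.Icc (-1 : ℝ) 1 := by norm_num
  have hc : ∀ N : ℕ, N < 2 * N + 1 := fun N => by omega
  have hs : ∀ N : ℕ, site N ⟨N, hc N⟩ = 0 := fun N => by simp [site]
  have hy : ApproachesThroughSites (fun _ => 0) 0 := ⟨fun N => ⟨_, hs N⟩, tendsto_const_nhds⟩
  have hp := eventually_isProbabilityMeasure_initialLawGiven hμ hT h0 hy
  have hneg : ∀ᶠ N in atTop, initialLawGiven N T (μ N) 0 (Set.Iio 0) =
      initialLawGiven N T (μ N) 0 (Set.Ioi 0) := by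
    filter_upwards [eventually_gt_atTop 0] with N hN
    have hrev : Fin.rev (⟨N, hc N⟩ : Fin (2 * N + 1)) = ⟨N, hc N⟩ := by
      ext; rw [Fin.val_rev]; dsimp only; omega
    have := jointMass_neg T (hsymm N) hrev (Set.Ioi 0)
    rw [show (fun x : ℝ => -x) ⁻¹' Set.Ioi 0 = Set.Iio 0 by ext; simp] at this
    rw [← hs N, initialLawGiven_apply hN.ne' T (μ N) _ measurableSet_Iio,
      initialLawGiven_apply hN.ne' T (μ N) _ measurableSet_Ioi, hs N, this]
  have hhalf : ∀ᶠ N in atTop, IsProbabilityMeasure (initialLawGiven N T (μ N) 0) ∧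
      initialLawGiven N T (μ N) 0 (Set.Ioi 0) ≤ 1 / 2 := by
    filter_upwards [hp, hneg] with N i hN
    refine ⟨i, ?_⟩
    have hle : initialLawGiven N T (μ N) 0 (Set.Ioi 0) + initialLawGiven N T (μ N) 0 (Set.Ioi 0)
        ≤ 1 := by
      nth_rw 1 [← hN]
      have hd : Disjoint (Set.Iio (0 : ℝ)) (Set.Ioi 0) :=
        Set.disjoint_left.2 fun z h1 h2 => lt_asymm (Set.mem_Iio.1 h1) (Set.mem_Ioi.1 h2)
      rw [← measure_union hd measurableSet_Ioi]
      exact prob_le_one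
    rw [ENNReal.le_div_iff_mul_le (by simp) (by simp), mul_two]
    exact hle
  have h1 : x ∉ Set.Ioi 0 := hx.notMem_of_measure_le isOpen_Ioi hhalf
  have h2 : x ∉ Set.Iio 0 := hx.notMem_of_measure_le isOpen_Iio (by
    filter_upwards [hhalf, hneg] with N h hN using ⟨h.1, hN.trans_le h.2⟩)
  have h3 : x ∉ Set.Ioo (-(a / 2)) (a / 2) := by
    refine hx.notMem_of_measure_le isOpen_Ioo ?_
    have hlim := tendsto_initialLawGiven_zero hμ hT h0 hy
      (isClosed_Icc (a := -(a / 2)) (b := a / 2)) fun z hz hopt => by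
      have := hwell 0 h0 z hopt
      linarith [abs_le.2 hz]
    filter_upwards [hp, hlim.eventually (gt_mem_nhds (show (0 : ℝ≥0∞) < 1 / 2 by simp))]
      with N i hN using ⟨i, (measure_mono Set.Ioo_subset_Icc_self).trans hN.le⟩
  rw [Set.mem_Ioi, not_lt] at h1
  rw [Set.mem_Iio, not_lt] at h2
  exact h3 ⟨by linarith, by linarith⟩

theorem badPoints_eq_singleton (ha₀ : 0 < a) (hμ : IsInitialSequence a μ) (hT : 0 < T)
    (hwell : ∀ b ∈ Set.Icc (-1 : ℝ) 1, ∀ x,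
      IsOptimalStart a (Real.exp (-2 * T)) b x → 3 * a / 4 ≤ |x|) :
    badPoints μ T = {0} := by
  obtain ⟨r0, r1⟩ := exp_neg_two_mul_mem hT
  refine Set.eq_singleton_iff_unique_mem.2 ⟨⟨by norm_num,
    not_conditionedConvergesToPointMass_zero ha₀ hμ hT hwell,
    conditionedLawsSeparate_zero ha₀ hμ hT hwell⟩, fun b hb => ?_⟩
  by_contra hb0
  exact hb.2.1 (conditionedConvergesToPointMass_of_unique hμ hT hb.1 fun x y hx hy =>
    hx.unique_of_ne_zero ha₀ r0 r1 hwell hb.1 hb0 hy)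

end LongTime

theorem mainTheorem7 (a : ℝ) (ha₀ : 0 < a) (ha₁ : a < 1) :
    (∀ T b : ℝ, 0 < T → b ∈ Set.Icc (-1 : ℝ) 1 →
      (∃ γ : ℝ → ℝ, IsOptimalPathTo a T b γ) ∧
      ∀ γ : ℝ → ℝ, IsOptimalPathTo a T b γ →
        ∃ C₁ C₂ : ℝ,
          (∀ t ∈ Set.Icc 0 T, γ t = C₁ * Real.exp (2 * t) + C₂ * Real.exp (-2 * t)) ∧
          C₁ * Real.exp (2 * T) + C₂ * Real.exp (-2 * T) = b ∧
          (b = 0 ∨ |γ 0| < 1 → ∀ p₀ : ℝ, p₀ = 4 * γ 0 * (γ 0 ^ 2 - a ^ 2) →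
            2 * (C₁ - C₂) =
              spinBirth (γ 0) * Real.exp p₀ - spinDeath (γ 0) * Real.exp (-p₀))) ∧
    (∃ T₀ : ℝ, 0 < T₀ ∧ ∀ μ : ℕ → Measure ℝ, IsInitialSequence a μ →
      ∀ T : ℝ, 0 < T → T ≤ T₀ → badPoints μ T = ∅) ∧
    (∃ T₁ : ℝ, 0 < T₁ ∧ ∀ μ : ℕ → Measure ℝ, IsInitialSequence a μ →
      ∀ T : ℝ, T₁ ≤ T → badPoints μ T = {0} ∧
        ((∀ N, (μ N).map (fun x => -x) = μ N) →
          ¬ ∃ x : ℝ, WeaklyTendsto (fun N => initialLawGiven N T (μ N) 0)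
            (Measure.dirac x))) := by
  refine ⟨fun T b hT hb => ⟨exists_isOptimalPathTo a hT hb, fun γ hγ =>
    hγ.exists_coeff ha₀ ha₁ hT hb⟩, ?_, ?_⟩
  · obtain ⟨T₀, hT₀, h⟩ := exists_time_unique_start a
    exact ⟨T₀, hT₀, fun μ hμ T hT hle => badPoints_eq_empty_of_unique hμ hT (h T hT hle)⟩
  · obtain ⟨T₁, hT₁, h⟩ := exists_time_start_near_wells ha₀ ha₁
    exact ⟨T₁, hT₁, fun μ hμ T hle =>
      ⟨badPoints_eq_singleton ha₀ hμ (hT₁.trans_le hle) (h T hle),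
        not_weaklyTendsto_zero_of_symmetric ha₀ hμ (hT₁.trans_le hle) (h T hle)⟩⟩
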